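/- Let $q$ be a power of a prime, $k=\mathbb F_q(\theta)$, let $k_\infty=\mathbb F_q((1/\theta))$ be its completion at the infinite place, $\overline{k_\infty}$ an algebraic closure of $k_\infty$, $\bar k$ the algebraic closure of $k$ in $\overline{k_\infty}$, and $\mathbb C_\infty$ the completion of $\overline{k_\infty}$ for the absolute value $|\cdot|_\infty$ with $|\theta|_\infty=q$. For $n\in\mathbb Z$ and $f=\sum_i a_it^i\in\mathbb C_\infty[[t]]$ put $f^{(n)}=\sum_i a_i^{q^n}t^i$. Fix a $(q-1)$-th root $\tilde\theta$ of $-\theta$ and let $\Omega(t)=\tilde\theta^{-q}\prod_{i\ge1}\bigl(1-t/\theta^{q^i}\bigr)\in\mathbb C_\infty[[t]]$. Let $\mathcal E$ be the ring of entire functions: power series $\sum_n a_nt^n\in\bar k[[t]]$ with $\lim_n\sqrt[n]{|a_n|_\infty}=0$ and $[k_\infty(a_0,a_1,\dots):k_\infty]<\infty$. For $Q=\sum_i a_it^i\in\bar k[t]$ put $\|Q\|_\infty=\max_i|a_i|_\infty$; the Gauss norm of a power series is the supremum of the absolute values of its coefficients. Let $\mathfrak s=(s_1,\dots,s_d)$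 be a $d$-tuple of positive integers and let $\mathfrak Q=(Q_1,\dots,Q_d)\in\bar k[t]^d$ be such that, as $0\le i_d<\cdots<i_1\to\infty$, $$\Bigl(\|Q_1\|_\infty/|\theta|_\infty^{\frac{qs_1}{q-1}}\Bigr)^{q^{i_1}}\cdots\Bigl(\|Q_d\|_\infty/|\theta|_\infty^{\frac{qs_d}{q-1}}\Bigr)^{q^{i_d}}\longrightarrow0.\qquad(*)$$ Then: (1) The two series in $$L_{\mathfrak s,\mathfrak Q}(t):=\sum_{i_1>\cdots>i_d\ge0}(\Omega^{s_d}Q_d)^{(i_d)}\cdots(\Omega^{s_1}Q_1)^{(i_1)}=\Omega^{s_1+\cdots+s_d}\sum_{i_1>\cdots>i_d\ge0}\frac{Q_d^{(i_d)}\cdots Q_1^{(i_1)}}{\bigl((t-\theta^q)\cdots(t-\theta^{q^{i_d}})\bigr)^{s_d}\cdots\bigl((t-\theta^q)\cdots(t-\theta^{q^{i_1}})\bigr)^{s_1}}$$ converge in the Gauss norm, and the equality holds. (2) $L_{\mathfrak s,\mathfrak Q}$ is an entire function, that is, $L_{\mathfrak s,\mathfrak Q}\in\mathcal E$. (3) Let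 $\Phi\in\mathrm{Mat}_{d+1}(\bar k[t])$ be the lower bidiagonal matrix with diagonal entries $\Phi_{jj}=(t-\theta)^{s_j+\cdots+s_d}$ for $1\le j\le d$ and $\Phi_{d+1,d+1}=1$, with subdiagonal entries $\Phi_{j+1,j}=Q_j^{(-1)}(t-\theta)^{s_j+\cdots+s_d}$ for $1\le j\le d$, and with all other entries $0$. Then the system $\psi^{(-1)}=\Phi\psi$ has a solution $\psi\in\mathrm{Mat}_{(d+1)\times1}(\mathcal E)$ whose last coordinate is $L_{\mathfrak s,\mathfrak Q}$. Moreover, put $L_1=1$ and, for $1\le j\le d$, let $L_{j+1}$ be the series $L$ of the tuples $(s_1,\dots,s_j)$ and $(Q_1,\dots,Q_j)$. If each pair of initial tuples $(s_1,\dots,s_j)$, $(Q_1,\dots,Q_j)$, $1\le j\le d$, satisfies the analogue of $(*)$, then $$\psi=\bigl(\Omega^{s_1+\cdots+s_d},\ \Omega^{s_2+\cdots+s_d}L_2,\ \dots,\ \Omega^{s_d}L_d,\ L_{d+1}\bigr)^{\mathrm{tr}}$$ is such a solution; and these analogues of $(*)$ all hold if $Q_2,\dots,Q_d$ are nonzero.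 -/

import Mathlib

open scoped PowerSeries PowerSeries.WithPiTopology

noncomputable section

namespace CarlitzTwist

variable (Fq : Type*) [Field Fq] [Fintype Fq]

/-- The absolute value at infinity on `k = Fq(θ)`: `|f| = q ^ (deg num - deg den)` for `f ≠ 0`, so
that `|θ| = q`. The variable `θ` is `RatFunc.X`. -/
def inftyAbs : AbsoluteValue (RatFunc Fq) ℝ := by
  classical
  have hq : (1 : ℝ) < Fintype.card Fq := by exact_mod_cast Fintype.one_lt_card
  exact
  { toFun := fun f => if f = 0 then 0 else (Fintype.card Fq : ℝ) ^ f.intDegree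
    map_mul' := by
      intro x y
      by_cases hx : x = 0
      · simp [hx]
      by_cases hy : y = 0
      · simp [hy]
      have h0 : (Fintype.card Fq : ℝ) ≠ 0 := by positivity
      simp [hx, hy, RatFunc.intDegree_mul hx hy, zpow_add₀ h0]
    nonneg' := by
      intro x
      split_ifs <;> positivity
    eq_zero' := by
      intro x
      have h0 : (Fintype.card Fq : ℝ) ≠ 0 := by positivity
      by_cases hx : x = 0
      · simp [hx]
      · simp [hx, zpow_ne_zero _ h0]
    add_le' := by
      intro x y
      by_cases hx : x = 0
      · simp [hx]
      by_cases hy : y = 0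
      · simp [hy]
      by_cases hxy : x + y = 0
      · simp only [hxy, hx, hy, if_true, if_false]
        positivity
      simp only [hx, hy, hxy, if_false]
      rcases le_max_iff.1 (RatFunc.intDegree_add_le hy hxy) with h | h
      · exact (zpow_le_zpow_right₀ hq.le h).trans (le_add_of_nonneg_right (by positivity))
      · exact (zpow_le_zpow_right₀ hq.le h).trans (le_add_of_nonneg_left (by positivity)) }

open Classical in
lemma inftyAbs_apply (f : RatFunc Fq) :
    inftyAbs Fq f = if f = 0 then 0 else (Fintype.card Fq : ℝ) ^ f.intDegree := by
  simp only [inftyAbs]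
  congr!

lemma inftyAbs_X : inftyAbs Fq RatFunc.X = Fintype.card Fq := by
  simp [inftyAbs_apply, RatFunc.X_ne_zero]

lemma isNonarchimedean_inftyAbs : IsNonarchimedean (inftyAbs Fq) := by
  classical
  have hq : (1 : ℝ) < Fintype.card Fq := by exact_mod_cast Fintype.one_lt_card
  intro x y
  by_cases hx : x = 0
  · simp [hx]
  by_cases hy : y = 0
  · simp [hy]
  by_cases hxy : x + y = 0
  · rw [hxy, map_zero]
    exact le_max_of_le_left ((inftyAbs Fq).nonneg _)
  simp only [inftyAbs_apply, hx, hy, hxy, if_false]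
  rcases le_max_iff.1 (RatFunc.intDegree_add_le hy hxy) with h | h
  · exact le_max_of_le_left (zpow_le_zpow_right₀ hq.le h)
  · exact le_max_of_le_right (zpow_le_zpow_right₀ hq.le h)

instance : IsUltrametricDist (WithAbs (inftyAbs Fq)) :=
  IsUltrametricDist.isUltrametricDist_of_isNonarchimedean_norm fun x y =>
    isNonarchimedean_inftyAbs Fq x.ofAbs y.ofAbs

/-- `k_∞ = Fq((1/θ))`, the completion of `k = Fq(θ)` at the place at infinity. -/
abbrev KInf := (inftyAbs Fq).Completion

instance : IsUltrametricDist (KInf Fq) :=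
  IsUltrametricDist.of_normedAlgebra (WithAbs (inftyAbs Fq))

instance : NontriviallyNormedField (KInf Fq) where
  non_trivial := by
    refine ⟨((WithAbs.toAbs (inftyAbs Fq) RatFunc.X : WithAbs (inftyAbs Fq)) : KInf Fq), ?_⟩
    rw [UniformSpace.Completion.norm_coe]
    change 1 < inftyAbs Fq RatFunc.X
    rw [inftyAbs_X]
    exact_mod_cast Fintype.one_lt_card

/-- A fixed algebraic closure of `k_∞`. -/
abbrev KInfBar := AlgebraicClosure (KInf Fq)

/-- The canonical extension of the absolute value at infinity to the algebraic closure. -/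
instance : NontriviallyNormedField (KInfBar Fq) :=
  spectralNorm.nontriviallyNormedField (KInf Fq) (KInfBar Fq)

instance : NormedAlgebra (KInf Fq) (KInfBar Fq) := spectralNorm.normedAlgebra _ _

/-- `ℂ_∞`, the completion of the algebraic closure of `k_∞`. -/
abbrev CInf := UniformSpace.Completion (KInfBar Fq)

/-- `k̄`, the algebraic closure of `k = Fq(θ)` inside the algebraic closure of `k_∞`. -/
abbrev KBar := algebraicClosure (RatFunc Fq) (KInfBar Fq)

instance : IsAlgClosed (KBar Fq) :=
  (algebraicClosure.isAlgClosure (RatFunc Fq) (KInfBar Fq)).isAlgClosed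

instance (R : Type*) [CommRing R] [Algebra R (KInfBar Fq)] :
    UniformContinuousConstSMul R (KInfBar Fq) where
  uniformContinuous_const_smul r := by
    simp_rw [Algebra.smul_def]
    exact (Ring.uniformContinuousConstSMul _).uniformContinuous_const_smul _

/-- The variable `θ`, as an element of `ℂ_∞`. -/
def theta : CInf Fq := algebraMap (RatFunc Fq) (CInf Fq) RatFunc.X

/-- The inclusion of `k̄` in `ℂ_∞`. -/
def kbarToC : KBar Fq →+* CInf Fq :=
  (algebraMap (KInfBar Fq) (CInf Fq)).comp (algebraMap (KBar Fq) (KInfBar Fq))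

/-- The automorphism `x ↦ x ^ q` of a field containing `Fq` in which every element has a `q`-th
root. -/
def qFrob (R : Type*) [Field R] [Algebra Fq R]
    (h : Function.Surjective fun x : R => x ^ Fintype.card Fq) : R ≃+* R :=
  RingEquiv.ofBijective (FiniteField.frobeniusAlgHom Fq R : R →+* R)
    ⟨RingHom.injective _, h⟩

lemma surjective_pow_of_isAlgClosed (R : Type*) [Field R] [IsAlgClosed R] :
    Function.Surjective fun x : R => x ^ Fintype.card Fq := fun x =>
  IsAlgClosed.exists_pow_nat_eq x Fintype.card_pos

lemma surjective_pow_CInf : Function.Surjective fun x : CInf Fq => x ^ Fintype.card Fq := by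
  have hq : Fintype.card Fq ≠ 0 := Fintype.card_ne_zero
  let F : CInf Fq →+* CInf Fq := (FiniteField.frobeniusAlgHom Fq (CInf Fq) : _ →+* _)
  have hF : ∀ x, F x = x ^ Fintype.card Fq := fun x => rfl
  have hd : ∀ x y, dist (F x) (F y) = dist x y ^ Fintype.card Fq := by
    intro x y
    rw [dist_eq_norm, dist_eq_norm, ← map_sub, hF, norm_pow]
  have hu : IsUniformInducing F := by
    rw [Metric.isUniformInducing_iff]
    constructor
    · refine uniformContinuous_addMonoidHom_of_continuous (f := F) ?_
      exact continuous_pow _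
    · intro δ hδ
      refine ⟨δ ^ Fintype.card Fq, by positivity, fun {a b} h => ?_⟩
      rw [hd] at h
      exact lt_of_pow_lt_pow_left₀ _ hδ.le h
  have hc : IsClosed (Set.range F) := hu.isComplete_range.isClosed
  intro z
  have hz : z ∈ Set.range F := by
    refine closure_minimal ?_ hc (UniformSpace.Completion.denseRange_coe z)
    rintro _ ⟨x, rfl⟩
    obtain ⟨y, hy⟩ := surjective_pow_of_isAlgClosed Fq (KInfBar Fq) x
    refine ⟨algebraMap (KInfBar Fq) (CInf Fq) y, ?_⟩
    rw [hF, ← map_pow]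
    exact congrArg _ hy
  exact hz

/-- `x ↦ x ^ (q ^ n)` on `ℂ_∞`, for every integer `n`. -/
def frobC (n : ℤ) : CInf Fq ≃+* CInf Fq :=
  (qFrob Fq (CInf Fq) (surjective_pow_CInf Fq) : RingAut (CInf Fq)) ^ n

/-- `x ↦ x ^ (q ^ n)` on `k̄`, for every integer `n`. -/
def frobKBar (n : ℤ) : KBar Fq ≃+* KBar Fq :=
  (qFrob Fq (KBar Fq) (surjective_pow_of_isAlgClosed Fq _) : RingAut (KBar Fq)) ^ n

/-- The `n`-fold twist `∑ aᵢ tⁱ ↦ ∑ aᵢ ^ (q ^ n) tⁱ` on `ℂ_∞⟦t⟧`, for every integer `n`. -/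
def twist (n : ℤ) : (CInf Fq)⟦X⟧ →+* (CInf Fq)⟦X⟧ :=
  PowerSeries.map (frobC Fq n : CInf Fq →+* CInf Fq)

/-- The `n`-fold twist on `k̄[t]`, for every integer `n`. -/
def polyTwist (n : ℤ) : Polynomial (KBar Fq) →+* Polynomial (KBar Fq) :=
  Polynomial.mapRingHom (frobKBar Fq n : KBar Fq →+* KBar Fq)

/-- The inclusion `k̄[t] ⊆ ℂ_∞⟦t⟧`. -/
def polyToPS : Polynomial (KBar Fq) →+* (CInf Fq)⟦X⟧ :=
  Polynomial.coeToPowerSeries.ringHom.comp (Polynomial.mapRingHom (kbarToC Fq))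

/-- The ring `𝓔` of entire functions: power series `∑ aₙ tⁿ` with coefficients in `k̄` such that
`|aₙ|^(1/n) → 0` and `[k_∞(a₀, a₁, …) : k_∞] < ∞`. -/
def IsEntire (f : (CInf Fq)⟦X⟧) : Prop :=
  (∀ n, PowerSeries.coeff n f ∈ Set.range (kbarToC Fq)) ∧
  Filter.Tendsto (fun n : ℕ => ‖PowerSeries.coeff n f‖ ^ (1 / (n : ℝ))) Filter.atTop (nhds 0) ∧
  FiniteDimensional (KInf Fq)
    (IntermediateField.adjoin (KInf Fq) (Set.range fun n : ℕ => PowerSeries.coeff n f))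

/-- `‖Q‖_∞`, the maximum of the absolute values of the coefficients of `Q`. -/
def gaussNorm (Q : Polynomial (KBar Fq)) : ℝ := (Q.map (kbarToC Fq)).supNorm

/-- The unconditional convergence of `∑ᵢ fᵢ` to `g` in the Gauss norm `‖∑ aₙ tⁿ‖ = supₙ |aₙ|`, that
is, in the Tate algebra when its terms lie there. -/
def HasGaussSum {ι : Type*} (f : ι → (CInf Fq)⟦X⟧) (g : (CInf Fq)⟦X⟧) : Prop :=
  TendstoUniformly (fun (S : Finset ι) (n : ℕ) => PowerSeries.coeff n (∑ i ∈ S, f i))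
    (fun n => PowerSeries.coeff n g) Filter.atTop

variable {Fq}

/-- `Ω(t) = θ̃^(-q) ∏_{i ≥ 1} (1 - t / θ^(q^i))`, the product being taken coefficientwise in
`ℂ_∞⟦t⟧`. Here `θ̃` is a `(q-1)`-th root of `-θ`. -/
def Omega (θt : CInf Fq) : (CInf Fq)⟦X⟧ :=
  PowerSeries.C (θt ^ Fintype.card Fq)⁻¹ *
    ∏' i : ℕ, (1 - PowerSeries.C (theta Fq ^ (Fintype.card Fq) ^ (i + 1))⁻¹ * PowerSeries.X)

/-- The index tuples `i₁ > ⋯ > i_d ≥ 0`. -/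
abbrev DecTuple (d : ℕ) := {i : Fin d → ℕ // StrictAnti i}

/-- The condition that
`(‖Q₁‖ / |θ^(q s₁/(q-1))|)^(q^i₁) ⋯ (‖Q_d‖ / |θ^(q s_d/(q-1))|)^(q^i_d) → 0`
as `0 ≤ i_d < ⋯ < i₁ → ∞`. -/
def NormDecay {d : ℕ} (s : Fin d → ℕ) (Q : Fin d → Polynomial (KBar Fq)) : Prop :=
  ∀ ε : ℝ, 0 < ε → ∃ N : ℕ, ∀ (i : DecTuple d) (hd : 0 < d), N ≤ i.1 ⟨0, hd⟩ →
    ∏ m, (gaussNorm Fq (Q m) /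
      ‖theta Fq‖ ^ ((Fintype.card Fq : ℝ) * s m / ((Fintype.card Fq : ℝ) - 1))) ^
        (Fintype.card Fq) ^ i.1 m < ε

/-- The term `(Ω^{s_d} Q_d)^{(i_d)} ⋯ (Ω^{s₁} Q₁)^{(i₁)}`. -/
def lTerm (θt : CInf Fq) {d : ℕ} (s : Fin d → ℕ) (Q : Fin d → Polynomial (KBar Fq))
    (i : DecTuple d) : (CInf Fq)⟦X⟧ :=
  ∏ m, twist Fq (i.1 m : ℤ) (Omega θt ^ s m * polyToPS Fq (Q m))

/-- The series `L_{s,Q}(t) = ∑_{i₁ > ⋯ > i_d ≥ 0} (Ω^{s_d} Q_d)^{(i_d)} ⋯ (Ω^{s₁} Q₁)^{(i₁)}`, the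
sum being taken coefficientwise. -/
def lSeries (θt : CInf Fq) {d : ℕ} (s : Fin d → ℕ) (Q : Fin d → Polynomial (KBar Fq)) :
    (CInf Fq)⟦X⟧ :=
  ∑' i : DecTuple d, lTerm θt s Q i

/-- The term
`Q_d^{(i_d)} ⋯ Q₁^{(i₁)} / (((t-θ^q)⋯(t-θ^{q^{i_d}}))^{s_d} ⋯ ((t-θ^q)⋯(t-θ^{q^{i₁}}))^{s₁})`
as a power series in `t`; each denominator has a nonzero constant term. -/
def quotTerm {d : ℕ} (s : Fin d → ℕ) (Q : Fin d → Polynomial (KBar Fq)) (i : DecTuple d) :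
    (CInf Fq)⟦X⟧ :=
  ∏ m, (twist Fq (i.1 m : ℤ) (polyToPS Fq (Q m)) *
    ((∏ l ∈ Finset.range (i.1 m),
      (PowerSeries.X - PowerSeries.C (theta Fq ^ (Fintype.card Fq) ^ (l + 1)))) ^ s m)⁻¹)

/-- The first `a` entries of a `d`-tuple, for `a ≤ d`. -/
def initial {α : Type*} {d : ℕ} (x : Fin d → α) (a : Fin (d + 1)) : Fin a.1 → α :=
  fun m => x (Fin.castLE a.is_le m)

/-- `s_{a+1} + ⋯ + s_d`, for `0 ≤ a ≤ d`. -/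
def tailSum {d : ℕ} (s : Fin d → ℕ) (a : Fin (d + 1)) : ℕ :=
  ∑ m : Fin d, if a.1 ≤ m.1 then s m else 0

variable (Fq) in
/-- The polynomial `t - θ` in `k̄[t]`. -/
def tSubTheta : Polynomial (KBar Fq) :=
  Polynomial.X - Polynomial.C (algebraMap (RatFunc Fq) (KBar Fq) RatFunc.X)

/-- The lower bidiagonal matrix `Φ` over `k̄[t]` of size `d + 1`, with rows and columns numbered
from `0`: its `a`-th diagonal entry is `(t-θ)^(s_{a+1} + ⋯ + s_d)`, the entry just below it is
`Q_{a+1}^{(-1)} (t-θ)^(s_{a+1} + ⋯ + s_d)`, and all other entries are `0`. -/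
def Phi {d : ℕ} (s : Fin d → ℕ) (Q : Fin d → Polynomial (KBar Fq)) :
    Matrix (Fin (d + 1)) (Fin (d + 1)) (Polynomial (KBar Fq)) :=
  fun b a =>
    if b = a then tSubTheta Fq ^ tailSum s a
    else if h : b.1 = a.1 + 1 then
      polyTwist Fq (-1) (Q ⟨a.1, by omega⟩) * tSubTheta Fq ^ tailSum s a
    else 0

/-- The vector `ψ`, numbered from `0`, whose `a`-th entry is `Ω^(s_{a+1} + ⋯ + s_d)` times the series
`L` of the tuples `(s₁, …, s_a)` and `(Q₁, …, Q_a)`, which is `1` for `a = 0`. -/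
def psiVec (θt : CInf Fq) {d : ℕ} (s : Fin d → ℕ) (Q : Fin d → Polynomial (KBar Fq)) :
    Fin (d + 1) → (CInf Fq)⟦X⟧ :=
  fun a => Omega θt ^ tailSum s a * lSeries θt (initial s a) (initial Q a)

/-- `ψ ∈ 𝓔^{d+1}` is a solution of `ψ^{(-1)} = Φ ψ` whose last coordinate is `L_{s,Q}`. -/
def IsEntireSolution (θt : CInf Fq) {d : ℕ} (s : Fin d → ℕ) (Q : Fin d → Polynomial (KBar Fq))
    (ψ : Fin (d + 1) → (CInf Fq)⟦X⟧) : Prop :=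
  (∀ a, IsEntire Fq (ψ a)) ∧
  (fun a => twist Fq (-1) (ψ a)) = ((Phi s Q).map (polyToPS Fq)).mulVec ψ ∧
  ψ (Fin.last d) = lSeries θt s Q

end CarlitzTwist

end

open scoped PowerSeries PowerSeries.WithPiTopology

noncomputable section

/-! Convergence is ultrametric. The Gauss norm of `Ω` is at most `|θ̃|^(-q) = |θ|^(-q/(q-1))`, so
the products in (*) bound the Gauss norms of the terms of `L`. Only finitely many tuples have `i₁ <
N`, so these terms tend to zero along the cofinite filter and the series converges by completeness.
Since the constant term of `Ω` has maximal norm, `Ω⁻¹` has finite Gauss norm, and convergence passes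
to the quotient series.

The functional equation `Ω^(-1) = (t - θ) Ω` follows by shifting the product. Splitting the tuples
according to `i_d > 0` or `i_d = 0` gives `L^(-1) = L + Q_d^(-1) (t - θ)^(s_d) Ω^(s_d) L'`, where
`L'` omits the last entry. These are the rows of `ψ^(-1) = Φ ψ`.

Entireness rests on `isEntire_of_twist_eq`: if `f^(-1) = (a + b t) f + g`, the coefficients satisfy
`c_n = (a c_n + b c_(n-1) + g_n)^q`. This equation is separable in `c_n`, so `c_n` is in `k̄`. As
`c_n → 0` and `q ≥ 2`, the `q`-th power forces decay faster than geometric. Once `c_n` is small, it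
is the limit of a fixed-point iteration inside a finite, hence closed, extension of `k_∞`. The
criterion applies to `Ω`, then inductively to each initial `L`.

The induction needs (*) for the initial tuples, which is deduced when `Q₂, …, Q_d` are nonzero. If
some `Q_m` is zero, then `L = 0` and `ψ = 0` serves. -/

namespace CarlitzTwist

/-! ### Gauss norm bounds and convergence of sums and products in the Gauss norm. -/

section GaussNorm

open PowerSeries Filter Topology

variable {K : Type*} [NormedField K]

/-- All coefficients of `f` have norm at most `C`. -/
def GaussLE (f : K⟦X⟧) (C : ℝ) : Prop := ∀ n, ‖coeff n f‖ ≤ C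

lemma GaussLE.nonneg {f : K⟦X⟧} {C : ℝ} (h : GaussLE f C) : 0 ≤ C := (norm_nonneg _).trans (h 0)

lemma GaussLE.mono {f : K⟦X⟧} {C D : ℝ} (h : GaussLE f C) (hCD : C ≤ D) : GaussLE f D :=
  fun n => (h n).trans hCD

lemma gaussLE_C (a : K) : GaussLE (C a) ‖a‖ := by
  intro n
  rw [coeff_C]
  split_ifs <;> simp

lemma gaussLE_one : GaussLE (1 : K⟦X⟧) 1 := by
  simpa using gaussLE_C (1 : K)

variable [IsUltrametricDist K]

lemma GaussLE.add {f g : K⟦X⟧} {C : ℝ} (hf : GaussLE f C) (hg : GaussLE g C) :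
    GaussLE (f + g) C := fun n => by
  rw [map_add]
  exact (IsUltrametricDist.norm_add_le_max _ _).trans (max_le (hf n) (hg n))

lemma GaussLE.sum {ι : Type*} {f : ι → K⟦X⟧} {C : ℝ} (hC : 0 ≤ C) {S : Finset ι}
    (h : ∀ i ∈ S, GaussLE (f i) C) : GaussLE (∑ i ∈ S, f i) C := fun n => by
  rw [map_sum]
  exact IsUltrametricDist.norm_sum_le_of_forall_le_of_nonneg hC fun i hi => h i hi n

lemma GaussLE.mul {f g : K⟦X⟧} {C D : ℝ} (hf : GaussLE f C) (hg : GaussLE g D) :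
    GaussLE (f * g) (C * D) := fun n => by
  rw [coeff_mul]
  refine IsUltrametricDist.norm_sum_le_of_forall_le_of_nonneg (mul_nonneg hf.nonneg hg.nonneg)
    fun p _ => ?_
  rw [norm_mul]
  exact mul_le_mul (hf _) (hg _) (norm_nonneg _) hf.nonneg

lemma GaussLE.prod {ι : Type*} {f : ι → K⟦X⟧} {C : ι → ℝ} (S : Finset ι)
    (h : ∀ i ∈ S, GaussLE (f i) (C i)) : GaussLE (∏ i ∈ S, f i) (∏ i ∈ S, C i) := by
  classical
  induction S using Finset.induction_on with
  | empty => simpa using gaussLE_one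
  | insert a S ha ih =>
    rw [Finset.prod_insert ha, Finset.prod_insert ha]
    exact (h a (Finset.mem_insert_self a S)).mul
      (ih fun i hi => h i (Finset.mem_insert_of_mem hi))

lemma GaussLE.pow {f : K⟦X⟧} {C : ℝ} (h : GaussLE f C) (n : ℕ) : GaussLE (f ^ n) (C ^ n) := by
  simpa using GaussLE.prod (f := fun _ => f) (C := fun _ => C) (Finset.range n) fun _ _ => h

/-- A power series whose constant coefficient has maximal norm is invertible, with Gauss norm the
inverse one. -/
lemma GaussLE.inv {f : K⟦X⟧} (h : GaussLE f ‖constantCoeff f‖) (h0 : constantCoeff f ≠ 0) :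
    GaussLE f⁻¹ ‖constantCoeff f‖⁻¹ := by
  intro n
  induction n using Nat.strong_induction_on with
  | _ n ih =>
    rw [coeff_inv]
    split_ifs
    · rw [norm_inv]
    · have hp : 0 < ‖constantCoeff f‖ := norm_pos_iff.2 h0
      rw [norm_mul, norm_neg, norm_inv]
      refine mul_le_of_le_one_right (inv_nonneg.2 hp.le) ?_
      refine IsUltrametricDist.norm_sum_le_of_forall_le_of_nonneg zero_le_one fun p _ => ?_
      split_ifs with hlt
      · rw [norm_mul, ← mul_inv_cancel₀ hp.ne']
        exact mul_le_mul (h _) (ih _ hlt) (norm_nonneg _) hp.le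
      · simp

/-- Series close to one are stable under products: `fg - 1 = (f - 1) g + (g - 1)`, and `ε ≤ 1` keeps
`g` in the unit ball. -/
lemma gaussLE_prod_sub_one {ι : Type*} {f : ι → K⟦X⟧} {ε : ℝ} (h0 : 0 ≤ ε) (h1 : ε ≤ 1)
    (S : Finset ι) (h : ∀ i ∈ S, GaussLE (f i - 1) ε) : GaussLE (∏ i ∈ S, f i - 1) ε := by
  classical
  induction S using Finset.induction_on with
  | empty => intro n; simpa using h0
  | insert a S ha ih =>
    have hg := ih fun i hi => h i (Finset.mem_insert_of_mem hi)
    have e : ∏ i ∈ insert a S, f i - 1 = (f a - 1) * ((∏ i ∈ S, f i - 1) + 1) +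
        (∏ i ∈ S, f i - 1) := by
      rw [Finset.prod_insert ha]
      ring
    rw [e]
    refine GaussLE.add ?_ hg
    simpa using (h a (Finset.mem_insert_self a S)).mul ((hg.mono h1).add gaussLE_one)

-- The Cauchy criterion for the Gauss norm, stated for an arbitrary net over finite sets so that it
-- serves both sums and products.
omit [IsUltrametricDist K] in
lemma exists_tendstoUniformly_coeff [CompleteSpace K] {ι : Type*} {F : Finset ι → K⟦X⟧}
    (h : ∀ ε : ℝ, 0 < ε → ∃ S₀, ∀ S, S₀ ⊆ S → GaussLE (F S - F S₀) ε) :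
    ∃ g, Tendsto F atTop (𝓝 g) ∧
      TendstoUniformly (fun S n => coeff n (F S)) (fun n => coeff n g) atTop := by
  classical
  have hc : ∀ n, CauchySeq fun S => coeff n (F S) := by
    intro n
    rw [Metric.cauchySeq_iff']
    intro ε hε
    obtain ⟨S₀, hS₀⟩ := h (ε / 2) (half_pos hε)
    refine ⟨S₀, fun S hS => ?_⟩
    rw [dist_eq_norm, ← map_sub]
    exact (hS₀ S hS n).trans_lt (half_lt_self hε)
  choose g hg using fun n => cauchySeq_tendsto_of_complete (hc n)
  refine ⟨PowerSeries.mk g, ?_, ?_⟩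
  · rw [PowerSeries.WithPiTopology.tendsto_iff_coeff_tendsto]
    simpa using hg
  · rw [Metric.tendstoUniformly_iff]
    intro ε hε
    obtain ⟨S₀, hS₀⟩ := h (ε / 3) (by positivity)
    have hlim : ∀ n, ‖g n - coeff n (F S₀)‖ ≤ ε / 3 := fun n =>
      le_of_tendsto ((hg n).sub_const _).norm <| by
        filter_upwards [eventually_ge_atTop S₀] with S hS
        rw [← map_sub]
        exact hS₀ S hS n
    filter_upwards [eventually_ge_atTop S₀] with S hS n
    have e : coeff n (PowerSeries.mk g) - coeff n (F S) =
        (g n - coeff n (F S₀)) - coeff n (F S - F S₀) := by simp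
    rw [dist_eq_norm, e]
    calc _ ≤ _ := norm_sub_le _ _
      _ ≤ ε / 3 + ε / 3 := add_le_add (hlim n) (hS₀ S hS n)
      _ < ε := by linarith

/-- A series whose terms tend to zero in the Gauss norm converges in the Gauss norm. -/
theorem summable_and_tendstoUniformly [CompleteSpace K] {ι : Type*} {f : ι → K⟦X⟧}
    (h : ∀ ε : ℝ, 0 < ε → ∀ᶠ i in cofinite, GaussLE (f i) ε) :
    Summable f ∧ TendstoUniformly (fun (S : Finset ι) n => coeff n (∑ i ∈ S, f i))
      (fun n => coeff n (∑' i, f i)) atTop := by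
  classical
  obtain ⟨g, hg, hu⟩ := exists_tendstoUniformly_coeff (F := fun S => ∑ i ∈ S, f i) (by
    intro ε hε
    have hfin := h ε hε
    rw [eventually_cofinite] at hfin
    refine ⟨hfin.toFinset, fun S hS => ?_⟩
    rw [← Finset.sum_sdiff hS, add_sub_cancel_right]
    refine GaussLE.sum hε.le fun i hi => ?_
    simpa using (Finset.mem_sdiff.1 hi).2)
  have hs : HasSum f g := hg
  rw [hs.tsum_eq]
  exact ⟨hs.summable, hu⟩

/-- A product whose factors tend to one in the Gauss norm converges in the Gauss norm. -/
theorem multipliable_and_tendstoUniformly [CompleteSpace K] {ι : Type*} {f : ι → K⟦X⟧}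
    (h1 : ∀ i, GaussLE (f i - 1) 1)
    (h : ∀ ε : ℝ, 0 < ε → ∀ᶠ i in cofinite, GaussLE (f i - 1) ε) :
    Multipliable f ∧ TendstoUniformly (fun (S : Finset ι) n => coeff n (∏ i ∈ S, f i))
      (fun n => coeff n (∏' i, f i)) atTop := by
  classical
  obtain ⟨g, hg, hu⟩ := exists_tendstoUniformly_coeff (F := fun S => ∏ i ∈ S, f i) (by
    intro ε hε
    -- The minimum with `1` meets the requirement `ε ≤ 1` of `gaussLE_prod_sub_one`.
    have hfin := h (min ε 1) (by positivity)
    rw [eventually_cofinite] at hfin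
    refine ⟨hfin.toFinset, fun S hS => ?_⟩
    have e : ∏ i ∈ S, f i - ∏ i ∈ hfin.toFinset, f i =
        (∏ i ∈ S \ hfin.toFinset, f i - 1) * ∏ i ∈ hfin.toFinset, f i := by
      rw [← Finset.prod_sdiff hS]
      ring
    rw [e]
    have h₁ : GaussLE (∏ i ∈ S \ hfin.toFinset, f i - 1) (min ε 1) :=
      gaussLE_prod_sub_one (by positivity) (min_le_right _ _) _ fun i hi => by
        simpa using (Finset.mem_sdiff.1 hi).2
    have h₂ : GaussLE (∏ i ∈ hfin.toFinset, f i) 1 := by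
      simpa using GaussLE.prod (C := fun _ => 1) hfin.toFinset fun i _ => by
        simpa using (h1 i).add gaussLE_one
    simpa using (h₁.mono (min_le_left _ _)).mul h₂)
  have hs : HasProd f g := hg
  rw [hs.tprod_eq]
  exact ⟨hs.multipliable, hu⟩

omit [IsUltrametricDist K] in
lemma GaussLE.of_tendsto {ι : Type*} {l : Filter ι} [l.NeBot] {F : ι → K⟦X⟧} {g : K⟦X⟧} {C : ℝ}
    (hg : Tendsto F l (𝓝 g)) (h : ∀ i, GaussLE (F i) C) : GaussLE g C := fun n =>
  le_of_tendsto ((PowerSeries.WithPiTopology.tendsto_iff_coeff_tendsto K F l g).1 hg n).norm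
    (Eventually.of_forall fun i => h i n)

omit [IsUltrametricDist K] in
lemma isRestricted_one_iff {f : K⟦X⟧} :
    IsRestricted 1 f ↔ Tendsto (fun n => coeff n f) atTop (𝓝 0) := by
  rw [isRestricted_iff', tendsto_zero_iff_norm_tendsto_zero (f := fun n => coeff n f)]
  simp only [one_pow, mul_one]

omit [IsUltrametricDist K] in
lemma isRestricted_one_of_tendstoUniformly {ι : Type*} {l : Filter ι} [l.NeBot] {F : ι → K⟦X⟧}
    {g : K⟦X⟧} (hg : TendstoUniformly (fun i n => coeff n (F i)) (fun n => coeff n g) l)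
    (h : ∀ i, IsRestricted 1 (F i)) : IsRestricted 1 g := by
  rw [isRestricted_one_iff]
  exact hg.tendsto_of_eventually_tendsto
    (Eventually.of_forall fun i => isRestricted_one_iff.1 (h i)) tendsto_const_nhds

end GaussNorm

/-! ### Decay of coefficients faster than any geometric sequence. -/

section Decay

open PowerSeries Filter Topology

variable {K : Type*} [NormedField K]

/-- Boundedness at radius `2 r` leaves a factor `2^(-n)` at radius `r`. -/
lemma isRestricted_of_bounded {f : K⟦X⟧} {r M : ℝ} (hr : 0 < r)
    (h : ∀ᶠ n in atTop, ‖coeff n f‖ * (2 * r) ^ n ≤ M) : IsRestricted r f := by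
  rw [isRestricted_iff']
  have hlim : Tendsto (fun n : ℕ => M * (1 / 2 : ℝ) ^ n) atTop (𝓝 0) := by
    simpa using (tendsto_pow_atTop_nhds_zero_of_lt_one (r := (1 / 2 : ℝ)) (by norm_num)
      (by norm_num)).const_mul M
  refine squeeze_zero' (Eventually.of_forall fun n => by positivity) ?_ hlim
  filter_upwards [h] with n hn
  calc ‖coeff n f‖ * r ^ n = ‖coeff n f‖ * (2 * r) ^ n * (1 / 2) ^ n := by
        rw [mul_assoc, ← mul_pow]; congr 2; ring
    _ ≤ _ := by gcongr

lemma tendsto_rpow_norm_coeff_iff {f : K⟦X⟧} :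
    Tendsto (fun n : ℕ => ‖coeff n f‖ ^ (1 / (n : ℝ))) atTop (𝓝 0) ↔
      ∀ r : ℝ, 0 < r → IsRestricted r f := by
  constructor
  · intro h r hr
    refine isRestricted_of_bounded (M := 1) hr ?_
    filter_upwards [h.eventually_le_const (u := 1 / (2 * r)) (by positivity), eventually_ge_atTop 1]
      with n hn hn1
    have hn0 : (n : ℝ) ≠ 0 := by positivity
    have : ‖coeff n f‖ ≤ (1 / (2 * r)) ^ n := by
      calc ‖coeff n f‖ = (‖coeff n f‖ ^ (1 / (n : ℝ))) ^ n := by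
            rw [← Real.rpow_natCast, ← Real.rpow_mul (norm_nonneg _), one_div_mul_cancel hn0,
              Real.rpow_one]
        _ ≤ _ := by gcongr
    calc _ ≤ (1 / (2 * r)) ^ n * (2 * r) ^ n := by gcongr
      _ = 1 := by rw [← mul_pow, one_div_mul_cancel (by positivity), one_pow]
  · intro h
    -- The strict form `n > N` excludes `n = 0`, where the exponent `1 / n` is `0`.
    rw [Metric.tendsto_atTop']
    intro ε hε
    have h2 := (isRestricted_iff' _ _).1 (h (2 / ε) (by positivity))
    obtain ⟨N, hN⟩ := eventually_atTop.1 (h2.eventually_le_const zero_lt_one)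
    refine ⟨N, fun n hn => ?_⟩
    have hn0 : (n : ℝ) ≠ 0 := by
      have : 0 < n := by omega
      positivity
    have hle : ‖coeff n f‖ ≤ (ε / 2) ^ n := by
      have := hN n hn.le
      calc ‖coeff n f‖ = ‖coeff n f‖ * (2 / ε) ^ n * (ε / 2) ^ n := by
            rw [mul_assoc, ← mul_pow, div_mul_div_cancel₀ hε.ne', div_self two_ne_zero]
            simp
        _ ≤ 1 * (ε / 2) ^ n := by gcongr
        _ = _ := one_mul _
    rw [dist_zero_right, Real.norm_of_nonneg (by positivity)]
    calc _ ≤ ((ε / 2) ^ n) ^ (1 / (n : ℝ)) := by gcongr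
      _ = ε / 2 := by
        rw [← Real.rpow_natCast, ← Real.rpow_mul (by positivity), mul_one_div_cancel hn0,
          Real.rpow_one]
      _ < ε := half_lt_self hε

/-- A sequence satisfying `u (n + 1) ≤ max (u n) 1` eventually is bounded. -/
lemma eventually_le_of_le_max {u : ℕ → ℝ} (h : ∀ᶠ n in atTop, u (n + 1) ≤ max (u n) 1) :
    ∃ M, ∀ᶠ n in atTop, u n ≤ M := by
  obtain ⟨N, hN⟩ := eventually_atTop.1 h
  refine ⟨max (u N) 1, eventually_atTop.2 ⟨N, fun n hn => ?_⟩⟩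
  induction n, hn using Nat.le_induction with
  | base => exact le_max_left _ _
  | succ n hn ih => exact (hN n hn).trans (max_le ih (le_max_right _ _))

/-- A null sequence `c` with `c n = (a * c n + b * c (n - 1) + g n) ^ q`, where `g` decays faster
than any geometric sequence, decays faster than any geometric sequence. -/
lemma isRestricted_of_coeff_eq_pow [IsUltrametricDist K] {q : ℕ} (hq : 2 ≤ q) {f g : K⟦X⟧} (a b : K)
    (hf : IsRestricted 1 f) (hg : ∀ r : ℝ, 0 < r → IsRestricted r g)
    (h : ∀ n, coeff (n + 1) f =
      (a * coeff (n + 1) f + (b * coeff n f + coeff (n + 1) g)) ^ q)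
    (r : ℝ) (hr : 0 < r) : IsRestricted r f := by
  -- With `r ≥ 1` the weights satisfy `R^(n+1) ≤ (R^(n+1))^q`, which the bound through `g` needs.
  wlog hr1 : 1 ≤ r generalizing r
  · have h1 := this 1 one_pos le_rfl
    rw [isRestricted_iff'] at h1 ⊢
    refine squeeze_zero (fun n => by positivity) (fun n => ?_) h1
    have := pow_le_one₀ hr.le (not_le.1 hr1).le (n := n)
    simpa using mul_le_mul_of_nonneg_left this (norm_nonneg (coeff n f))
  have hf0 : Tendsto (fun n => ‖coeff n f‖) atTop (𝓝 0) := by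
    simpa using (isRestricted_one_iff.1 hf).norm
  have hpow : ∀ C : ℝ, Tendsto (fun n => C * ‖coeff n f‖ ^ (q - 1)) atTop (𝓝 0) := fun C => by
    simpa [zero_pow (show q - 1 ≠ 0 by omega)] using (hf0.pow (q - 1)).const_mul C
  set R := 2 * r with hR
  have hR1 : 1 ≤ R := by linarith
  have hsplit : ∀ x : ℝ, x ^ q = x ^ (q - 1) * x := fun x => by
    rw [← pow_succ]; congr 1; omega
  obtain ⟨M, hM⟩ := eventually_le_of_le_max (u := fun n => ‖coeff n f‖ * R ^ n) (by
    have hg1 := ((isRestricted_iff' _ _).1 (hg R (by positivity))).comp (tendsto_add_atTop_nat 1)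
    filter_upwards [((hpow (‖a‖ ^ q)).comp (tendsto_add_atTop_nat 1)).eventually_lt_const
        zero_lt_one, (hpow (‖b‖ ^ q * R)).eventually_le_const zero_lt_one,
      hg1.eventually_le_const zero_lt_one] with n h1 h2 h3
    simp only [Function.comp_apply] at h1 h3
    by_cases hc : coeff (n + 1) f = 0
    · simp [hc]
    have hle : ‖coeff (n + 1) f‖ ≤ max (‖b‖ * ‖coeff n f‖) ‖coeff (n + 1) g‖ ^ q := by
      have h4 : ‖coeff (n + 1) f‖ ≤ max (‖a‖ * ‖coeff (n + 1) f‖)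
          (max (‖b‖ * ‖coeff n f‖) ‖coeff (n + 1) g‖) ^ q := by
        conv_lhs => rw [h n, norm_pow]
        gcongr
        refine (IsUltrametricDist.norm_add_le_max _ _).trans (max_le_max (norm_mul_le _ _) ?_)
        exact (IsUltrametricDist.norm_add_le_max _ _).trans
          (max_le_max_right _ (norm_mul_le _ _))
      rcases le_total (‖a‖ * ‖coeff (n + 1) f‖) (max (‖b‖ * ‖coeff n f‖) ‖coeff (n + 1) g‖)
        with h5 | h5
      · rwa [max_eq_right h5] at h4
      -- If the term `a c` dominated, then `|c| ≤ |a|^q |c|^(q-1) |c| < |c|` for the small nonzero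
      -- coefficient `c`.
      · exfalso
        rw [max_eq_left h5, mul_pow, hsplit ‖coeff (n + 1) f‖, ← mul_assoc] at h4
        have := mul_lt_of_lt_one_left (norm_pos_iff.2 hc) h1
        linarith
    -- If the `b` term dominates, the weighted norm does not increase; if `g` dominates, it is at
    -- most `1`.
    rcases max_cases (‖b‖ * ‖coeff n f‖) ‖coeff (n + 1) g‖ with ⟨h5, -⟩ | ⟨h5, -⟩
    · refine le_max_of_le_left ?_
      rw [h5, mul_pow, hsplit ‖coeff n f‖] at hle
      calc _ ≤ ‖b‖ ^ q * (‖coeff n f‖ ^ (q - 1) * ‖coeff n f‖) * R ^ (n + 1) := by gcongr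
        _ = (‖b‖ ^ q * R * ‖coeff n f‖ ^ (q - 1)) * (‖coeff n f‖ * R ^ n) := by ring
        _ ≤ 1 * (‖coeff n f‖ * R ^ n) := by gcongr
        _ = _ := one_mul _
    · refine le_max_of_le_right ?_
      rw [h5] at hle
      calc _ ≤ ‖coeff (n + 1) g‖ ^ q * (R ^ (n + 1)) ^ q := by
            gcongr
            exact le_self_pow₀ (one_le_pow₀ hR1) (by omega)
        _ = (‖coeff (n + 1) g‖ * R ^ (n + 1)) ^ q := (mul_pow _ _ _).symm
        _ ≤ 1 := pow_le_one₀ (by positivity) h3)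
  exact isRestricted_of_bounded hr hM

end Decay

/-! ### Twists, and their compatibility with norms, limits and `k̄[t]`. -/

section Twist

open PowerSeries Filter Topology

variable (Fq : Type*) [Field Fq] [Fintype Fq]

instance : IsUltrametricDist (CInf Fq) := IsUltrametricDist.of_normedAlgebra (KInf Fq)

lemma two_le_card : 2 ≤ Fintype.card Fq := Fintype.one_lt_card

lemma frobC_add (m n : ℤ) (x : CInf Fq) : frobC Fq (m + n) x = frobC Fq m (frobC Fq n x) := by
  simp only [frobC, zpow_add]
  rfl

lemma frobC_zero (x : CInf Fq) : frobC Fq 0 x = x := rfl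

lemma frobC_one (x : CInf Fq) : frobC Fq 1 x = x ^ Fintype.card Fq := by
  simp only [frobC, zpow_one]
  rfl

lemma frobC_natCast (n : ℕ) (x : CInf Fq) : frobC Fq n x = x ^ Fintype.card Fq ^ n := by
  induction n with
  | zero => simp [frobC_zero]
  | succ n ih =>
    rw [Nat.cast_succ, add_comm, frobC_add, ih, frobC_one, ← pow_mul, pow_succ]

lemma frobC_neg_one_pow (x : CInf Fq) : frobC Fq (-1) x ^ Fintype.card Fq = x := by
  rw [← frobC_one, ← frobC_add]
  rfl

lemma frobKBar_neg_one_pow (x : KBar Fq) : frobKBar Fq (-1) x ^ Fintype.card Fq = x := by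
  have h : frobKBar Fq 1 (frobKBar Fq (-1) x) = x := by
    rw [frobKBar, frobKBar, ← RingAut.mul_apply, ← zpow_add]
    rfl
  conv_rhs => rw [← h]
  simp only [frobKBar, zpow_one]
  rfl

lemma kbarToC_frobKBar_neg_one (x : KBar Fq) :
    kbarToC Fq (frobKBar Fq (-1) x) = frobC Fq (-1) (kbarToC Fq x) := by
  apply (frobC Fq 1).injective
  rw [← frobC_add, frobC_one, ← map_pow, frobKBar_neg_one_pow]
  rfl

@[simp]
lemma coeff_twist (m : ℤ) (n : ℕ) (f : (CInf Fq)⟦X⟧) :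
    coeff n (twist Fq m f) = frobC Fq m (coeff n f) := by
  simp [twist]

lemma twist_add (m n : ℤ) (f : (CInf Fq)⟦X⟧) :
    twist Fq (m + n) f = twist Fq m (twist Fq n f) := by
  ext i
  simp [frobC_add]

lemma twist_zero (f : (CInf Fq)⟦X⟧) : twist Fq 0 f = f := by
  ext i
  simp [frobC_zero]

lemma twist_C (m : ℤ) (a : CInf Fq) : twist Fq m (C a) = C (frobC Fq m a) := by
  simp [twist]

lemma twist_X (m : ℤ) : twist Fq m X = X := by
  simp [twist]

/-- Nonnegative twists suffice: infinite sums and products are twisted forwards, and the inverse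
twist is applied only to the resulting identities. -/
lemma continuous_twist_natCast (m : ℕ) : Continuous (twist Fq m) := by
  rw [continuous_iff_continuousAt]
  intro f
  refine (PowerSeries.WithPiTopology.tendsto_iff_coeff_tendsto _ _ _ _).2 fun n => ?_
  simp only [coeff_twist, frobC_natCast]
  exact ((PowerSeries.WithPiTopology.continuous_coeff _ n).pow _).continuousAt

variable {Fq}

lemma GaussLE.twist {f : (CInf Fq)⟦X⟧} {M : ℝ} (h : GaussLE f M) (m : ℕ) :
    GaussLE (twist Fq m f) (M ^ Fintype.card Fq ^ m) := fun n => by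
  rw [coeff_twist, frobC_natCast, norm_pow]
  exact pow_le_pow_left₀ (norm_nonneg _) (h n) _

lemma isRestricted_one_twist {f : (CInf Fq)⟦X⟧} (h : IsRestricted 1 f) (m : ℕ) :
    IsRestricted 1 (twist Fq m f) := by
  rw [isRestricted_one_iff] at h ⊢
  simp only [coeff_twist, frobC_natCast]
  simpa using h.pow (Fintype.card Fq ^ m)

@[simp]
lemma coeff_polyToPS (P : Polynomial (KBar Fq)) (n : ℕ) :
    coeff n (polyToPS Fq P) = kbarToC Fq (P.coeff n) := by
  simp [polyToPS]

lemma polyToPS_polyTwist_neg_one (P : Polynomial (KBar Fq)) :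
    polyToPS Fq (polyTwist Fq (-1) P) = twist Fq (-1) (polyToPS Fq P) := by
  ext n
  rw [coeff_polyToPS, coeff_twist, coeff_polyToPS, ← kbarToC_frobKBar_neg_one]
  simp [polyTwist]

lemma gaussLE_polyToPS (P : Polynomial (KBar Fq)) : GaussLE (polyToPS Fq P) (gaussNorm Fq P) :=
  fun n => by
    simpa using! Polynomial.le_supNorm (P.map (kbarToC Fq)) n

lemma kbarToC_theta :
    kbarToC Fq (algebraMap (RatFunc Fq) (KBar Fq) RatFunc.X) = theta Fq := by
  rw [theta, kbarToC, RingHom.comp_apply, ← IsScalarTower.algebraMap_apply,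
    ← IsScalarTower.algebraMap_apply]

lemma polyToPS_tSubTheta : polyToPS Fq (tSubTheta Fq) = X - C (theta Fq) := by
  simp [polyToPS, tSubTheta, kbarToC_theta]

lemma norm_theta : ‖theta Fq‖ = Fintype.card Fq := by
  rw [theta, IsScalarTower.algebraMap_apply (RatFunc Fq) (KInf Fq) (CInf Fq), norm_algebraMap',
    ← inftyAbs_X]
  exact UniformSpace.Completion.norm_coe (WithAbs.toAbs (inftyAbs Fq) RatFunc.X)

end Twist

/-! ### Entire functions and the criterion for entireness by a twisted equation. -/

section Entire

open PowerSeries Filter Topology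

variable {Fq : Type*} [Field Fq] [Fintype Fq]

lemma isIntegral_kbarToC (x : KBar Fq) : IsIntegral (KInf Fq) (kbarToC Fq x) :=
  (Algebra.IsIntegral.isIntegral (R := KInf Fq) (algebraMap (KBar Fq) (KInfBar Fq) x)).map
    (IsScalarTower.toAlgHom (KInf Fq) (KInfBar Fq) (CInf Fq))

/-- An intermediate field of `ℂ_∞ / k_∞` generated by finitely many elements of `k̄`. -/
lemma finiteDimensional_adjoin_of_subset_range {S : Set (CInf Fq)} (hS : S.Finite)
    (h : S ⊆ Set.range (kbarToC Fq)) :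
    FiniteDimensional (KInf Fq) (IntermediateField.adjoin (KInf Fq) S) := by
  have := hS.to_subtype
  refine IntermediateField.finiteDimensional_adjoin fun x hx => ?_
  obtain ⟨y, rfl⟩ := h hx
  exact isIntegral_kbarToC y

/-- This form is stable under products: each radius is treated separately, and any finite extension
containing the coefficients will do, so composites may be taken. -/
lemma isEntire_iff {f : (CInf Fq)⟦X⟧} :
    IsEntire Fq f ↔ (∀ n, coeff n f ∈ (kbarToC Fq).range) ∧ (∀ r : ℝ, 0 < r → IsRestricted r f) ∧
      ∃ E : IntermediateField (KInf Fq) (CInf Fq), FiniteDimensional (KInf Fq) E ∧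
        ∀ n, coeff n f ∈ E := by
  refine and_congr Iff.rfl (and_congr tendsto_rpow_norm_coeff_iff ⟨fun h => ⟨_, h, fun n =>
    IntermediateField.subset_adjoin _ _ ⟨n, rfl⟩⟩, ?_⟩)
  rintro ⟨E, hE, h⟩
  have hle : IntermediateField.adjoin (KInf Fq) (Set.range fun n : ℕ => coeff n f) ≤ E := by
    rw [IntermediateField.adjoin_le_iff]
    rintro _ ⟨n, rfl⟩
    exact h n
  exact FiniteDimensional.of_injective (IntermediateField.inclusion hle).toLinearMap
    (IntermediateField.inclusion hle).injective

lemma IsEntire.mul {f g : (CInf Fq)⟦X⟧} (hf : IsEntire Fq f) (hg : IsEntire Fq g) :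
    IsEntire Fq (f * g) := by
  rw [isEntire_iff] at *
  obtain ⟨hf1, hf2, E, hE, hf3⟩ := hf
  obtain ⟨hg1, hg2, E', hE', hg3⟩ := hg
  refine ⟨fun n => ?_, fun r hr => isRestricted.mul r (hf2 r hr) (hg2 r hr), E ⊔ E',
    IntermediateField.finiteDimensional_sup _ _, fun n => ?_⟩
  · rw [coeff_mul]
    exact sum_mem fun p _ => mul_mem (hf1 _) (hg1 _)
  · rw [coeff_mul]
    exact sum_mem fun p _ => mul_mem ((le_sup_left : E ≤ E ⊔ E') (hf3 _))
      ((le_sup_right : E' ≤ E ⊔ E') (hg3 _))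

lemma isRestricted_coe (P : Polynomial (CInf Fq)) (r : ℝ) :
    IsRestricted r (P : (CInf Fq)⟦X⟧) := by
  rw [isRestricted_iff']
  refine tendsto_const_nhds.congr' ?_
  filter_upwards [eventually_gt_atTop P.natDegree] with n hn
  simp [Polynomial.coeff_eq_zero_of_natDegree_lt hn]

lemma isEntire_polyToPS (P : Polynomial (KBar Fq)) : IsEntire Fq (polyToPS Fq P) := by
  rw [isEntire_iff]
  refine ⟨fun n => ⟨P.coeff n, by simp⟩, fun r _ => isRestricted_coe _ r, _,
    finiteDimensional_adjoin_of_subset_range (S := kbarToC Fq '' Set.range P.coeff) ?_ ?_,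
    fun n => IntermediateField.subset_adjoin _ _ ⟨P.coeff n, ⟨n, rfl⟩, by simp⟩⟩
  · refine Set.Finite.image _ ((P.support.finite_toSet.image P.coeff).union
      (Set.finite_singleton 0) |>.subset ?_)
    rintro _ ⟨n, rfl⟩
    by_cases hn : P.coeff n = 0
    · exact Or.inr hn
    · exact Or.inl ⟨n, by simpa using hn, rfl⟩
  · exact Set.image_subset_range _ _

lemma isEntire_one : IsEntire Fq 1 := by
  simpa using isEntire_polyToPS (1 : Polynomial (KBar Fq))

lemma isEntire_zero : IsEntire Fq 0 := by
  simpa using isEntire_polyToPS (0 : Polynomial (KBar Fq))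

lemma IsEntire.pow {f : (CInf Fq)⟦X⟧} (hf : IsEntire Fq f) (n : ℕ) : IsEntire Fq (f ^ n) := by
  induction n with
  | zero => simpa using isEntire_one
  | succ n ih => rw [pow_succ]; exact ih.mul hf

/-- A solution of `x = (a x + e) ^ q` with `a` and `e` in `k̄` lies in `k̄`. -/
lemma mem_range_kbarToC_of_eq_pow {x a e : CInf Fq} (ha : a ∈ (kbarToC Fq).range)
    (he : e ∈ (kbarToC Fq).range) (h : x = (a * x + e) ^ Fintype.card Fq) :
    x ∈ (kbarToC Fq).range := by
  obtain ⟨a, rfl⟩ := ha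
  obtain ⟨e, rfl⟩ := he
  have hp0 : (Polynomial.C a * Polynomial.X + Polynomial.C e) ^ Fintype.card Fq -
      (Polynomial.X : Polynomial (KBar Fq)) ≠ 0 := by
    -- In characteristic dividing `q` the derivative of this polynomial is `-1`, so it is not zero.
    intro h0
    have hq : ((Fintype.card Fq : ℕ) : KBar Fq) = 0 := by
      rw [← map_natCast (algebraMap Fq (KBar Fq))]
      simp
    have := congrArg Polynomial.derivative h0
    simp [Polynomial.derivative_pow, hq] at this
  refine (IsAlgClosed.splits _).mem_range_of_isRoot hp0 ?_
  simp only [Polynomial.IsRoot.def, Polynomial.map_sub, Polynomial.map_pow, Polynomial.map_add,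
    Polynomial.map_mul, Polynomial.map_C, Polynomial.map_X, Polynomial.eval_sub,
    Polynomial.eval_pow, Polynomial.eval_add, Polynomial.eval_mul, Polynomial.eval_C,
    Polynomial.eval_X]
  rw [← h, sub_self]

/-- A small solution of `x = (a x + e) ^ q` lies in every finite extension of `k_∞` that contains
`a` and `e`. -/
lemma mem_of_eq_pow {E : IntermediateField (KInf Fq) (CInf Fq)} [FiniteDimensional (KInf Fq) E]
    {x a e : CInf Fq} (ha : a ∈ E) (he : e ∈ E) (h : x = (a * x + e) ^ Fintype.card Fq)
    (hx : ‖a‖ ^ Fintype.card Fq * ‖x‖ ^ (Fintype.card Fq - 1) ≤ 1 / 2) : x ∈ E := by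
  set q := Fintype.card Fq with hq
  have hq2 : 2 ≤ q := two_le_card Fq
  -- Fixed-point iteration from `0`: it stays in `E`, and the smallness of `x` makes it converge to
  -- `x`.
  let y : ℕ → CInf Fq := fun k => (fun z => (a * z + e) ^ q)^[k] 0
  have hy : ∀ k, y (k + 1) = (a * y k + e) ^ q := fun k => Function.iterate_succ_apply' _ _ _
  have hyE : ∀ k, y k ∈ E := by
    intro k
    induction k with
    | zero => exact zero_mem E
    | succ k ih => rw [hy]; exact pow_mem (add_mem (mul_mem ha ih) he) _
  have hd : ∀ k, ‖y k - x‖ ≤ (1 / 2) ^ k * ‖x‖ := by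
    intro k
    induction k with
    | zero => simp [y]
    | succ k ih =>
      -- The `q`-th power map is additive, so the error is transformed by `z ↦ (a z)^q`.
      have e1 : y (k + 1) - x = (a * (y k - x)) ^ q := by
        conv_lhs => rw [hy, h]
        have := map_sub (frobC Fq 1) (a * y k + e) (a * x + e)
        rw [frobC_one, frobC_one, frobC_one] at this
        rw [← this]
        congr 1
        ring
      have hle : ‖y k - x‖ ≤ ‖x‖ := ih.trans (mul_le_of_le_one_left (norm_nonneg _)
        (pow_le_one₀ (by norm_num) (by norm_num)))
      have e2 : ‖y k - x‖ ^ q = ‖y k - x‖ ^ (q - 1) * ‖y k - x‖ := by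
        rw [← pow_succ]; congr 1; omega
      rw [e1, norm_pow, norm_mul, mul_pow, e2, ← mul_assoc]
      calc _ ≤ (‖a‖ ^ q * ‖x‖ ^ (q - 1)) * ((1 / 2) ^ k * ‖x‖) := by gcongr
        _ ≤ 1 / 2 * ((1 / 2) ^ k * ‖x‖) := by gcongr
        _ = _ := by ring
  have hlim : Tendsto y atTop (𝓝 x) := by
    rw [tendsto_iff_norm_sub_tendsto_zero]
    refine squeeze_zero (fun _ => norm_nonneg _) hd ?_
    simpa using (tendsto_pow_atTop_nhds_zero_of_lt_one (r := (1 / 2 : ℝ)) (by norm_num)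
      (by norm_num)).mul_const ‖x‖
  -- A finite-dimensional subspace over the complete field `k_∞` is closed.
  have hcl : IsClosed (E : Set (CInf Fq)) :=
    Submodule.closed_of_finiteDimensional (Subalgebra.toSubmodule E.toSubalgebra)
  exact hcl.mem_of_tendsto hlim (Eventually.of_forall hyE)

/-- A restricted power series `f` such that `f^(-1) - (a + b t) f` is entire, with `a` and `b` in
`k̄`, is entire. -/
theorem isEntire_of_twist_eq {f g : (CInf Fq)⟦X⟧} {a b : CInf Fq} (hf : IsRestricted 1 f)
    (hg : IsEntire Fq g) (ha : a ∈ (kbarToC Fq).range) (hb : b ∈ (kbarToC Fq).range)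
    (h : twist Fq (-1) f = (C a + C b * X) * f + g) : IsEntire Fq f := by
  rw [isEntire_iff] at hg ⊢
  obtain ⟨hg1, hg2, E', hE', hg3⟩ := hg
  have h0 : coeff 0 f = (a * coeff 0 f + coeff 0 g) ^ Fintype.card Fq := by
    conv_lhs => rw [← frobC_neg_one_pow Fq (coeff 0 f), ← coeff_twist, h]
    simp [add_mul, mul_assoc]
  have hs : ∀ n, coeff (n + 1) f =
      (a * coeff (n + 1) f + (b * coeff n f + coeff (n + 1) g)) ^ Fintype.card Fq := by
    intro n
    conv_lhs => rw [← frobC_neg_one_pow Fq (coeff (n + 1) f), ← coeff_twist, h]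
    rw [add_mul, mul_assoc, map_add, map_add, coeff_C_mul, coeff_C_mul, coeff_succ_X_mul, add_assoc]
  have hK : ∀ n, coeff n f ∈ (kbarToC Fq).range := by
    intro n
    induction n with
    | zero => exact mem_range_kbarToC_of_eq_pow ha (hg1 0) h0
    | succ n ih =>
      exact mem_range_kbarToC_of_eq_pow ha (add_mem (mul_mem hb ih) (hg1 _)) (hs n)
  refine ⟨hK, isRestricted_of_coeff_eq_pow (two_le_card Fq) a b hf hg2 hs, ?_⟩
  have hsmall : Tendsto (fun n => ‖a‖ ^ Fintype.card Fq * ‖coeff n f‖ ^ (Fintype.card Fq - 1))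
      atTop (𝓝 0) := by
    have := two_le_card Fq
    simpa [zero_pow (show Fintype.card Fq - 1 ≠ 0 by omega)] using
      ((isRestricted_one_iff.1 hf).norm.pow (Fintype.card Fq - 1)).const_mul
        (‖a‖ ^ Fintype.card Fq)
  obtain ⟨N, hN⟩ := eventually_atTop.1 (hsmall.eventually_le_const (show (0 : ℝ) < 1 / 2 by norm_num))
  -- The finitely many coefficients that may be too large for `mem_of_eq_pow` are adjoined by hand;
  -- all later ones then lie in the same field.
  let S : Set (CInf Fq) := {a, b} ∪ (fun n => coeff n f) '' Set.Iic N
  have hSK : S ⊆ Set.range (kbarToC Fq) := by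
    rintro _ ((rfl | rfl) | ⟨n, -, rfl⟩)
    exacts [ha, hb, hK n]
  have hSfin : S.Finite := (Set.toFinite _).union ((Set.finite_Iic N).image _)
  have hE := finiteDimensional_adjoin_of_subset_range hSfin hSK
  set E := IntermediateField.adjoin (KInf Fq) S with hEdef
  have hfin := IntermediateField.finiteDimensional_sup E E'
  have hSE : ∀ x ∈ S, x ∈ E ⊔ E' := fun x hx =>
    (le_sup_left : E ≤ E ⊔ E') (IntermediateField.subset_adjoin _ _ hx)
  have hgE : ∀ n, coeff n g ∈ E ⊔ E' := fun n => (le_sup_right : E' ≤ E ⊔ E') (hg3 n)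
  refine ⟨E ⊔ E', hfin, fun n => ?_⟩
  induction n with
  | zero => exact hSE _ (Or.inr ⟨0, Nat.zero_le N, rfl⟩)
  | succ n ih =>
    rcases le_total (n + 1) N with hn | hn
    · exact hSE _ (Or.inr ⟨n + 1, hn, rfl⟩)
    · exact mem_of_eq_pow (hSE a (Or.inl (Or.inl rfl)))
        (add_mem (mul_mem (hSE b (Or.inl (Or.inr rfl))) ih) (hgE _)) (hs n) (hN _ hn)

end Entire

/-! ### The function `Ω`: norm, functional equation, entireness. -/

section Omega

open PowerSeries Filter Topology

variable {Fq : Type*} [Field Fq] [Fintype Fq]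

lemma one_lt_norm_theta : 1 < ‖theta Fq‖ := by
  rw [norm_theta]
  exact_mod_cast Fintype.one_lt_card

lemma theta_ne_zero : theta Fq ≠ 0 := norm_pos_iff.1 (one_pos.trans one_lt_norm_theta)

lemma ne_zero_of_pow_eq_neg_theta {θt : CInf Fq}
    (hθt : θt ^ (Fintype.card Fq - 1) = -theta Fq) : θt ≠ 0 := by
  rintro rfl
  rw [zero_pow (by have := two_le_card Fq; omega)] at hθt
  exact theta_ne_zero (neg_eq_zero.1 hθt.symm)

variable (Fq) in
/-- The factor `1 - t / θ^(q^(i+1))` of `Ω`. -/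
def omegaFactor (i : ℕ) : (CInf Fq)⟦X⟧ :=
  1 - C (theta Fq ^ (Fintype.card Fq) ^ (i + 1))⁻¹ * X

lemma gaussLE_omegaFactor_sub_one (i : ℕ) :
    GaussLE (omegaFactor Fq i - 1) (‖theta Fq‖⁻¹ ^ i) := by
  intro n
  have h1 := one_lt_norm_theta (Fq := Fq)
  rw [omegaFactor, sub_sub_cancel_left, map_neg, norm_neg]
  rcases n with - | n
  · simp
  · rw [coeff_succ_mul_X, coeff_C]
    split_ifs
    · rw [norm_inv, norm_pow, inv_pow]
      gcongr
      · exact h1.le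
      · exact (Nat.le_succ i).trans (Nat.lt_pow_self (two_le_card Fq)).le
    · simp

lemma multipliable_omegaFactor_and_tendstoUniformly :
    Multipliable (omegaFactor Fq) ∧
      TendstoUniformly (fun (S : Finset ℕ) n => coeff n (∏ i ∈ S, omegaFactor Fq i))
        (fun n => coeff n (∏' i, omegaFactor Fq i)) atTop := by
  have h1 := one_lt_norm_theta (Fq := Fq)
  refine multipliable_and_tendstoUniformly (fun i => (gaussLE_omegaFactor_sub_one i).mono ?_) ?_
  · exact pow_le_one₀ (by positivity) (inv_le_one_of_one_le₀ h1.le)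
  · intro ε hε
    rw [Nat.cofinite_eq_atTop]
    filter_upwards [(tendsto_pow_atTop_nhds_zero_of_lt_one (by positivity)
      (inv_lt_one_of_one_lt₀ h1)).eventually_le_const hε] with i hi
    exact (gaussLE_omegaFactor_sub_one i).mono hi

lemma Omega_eq (θt : CInf Fq) :
    Omega θt = C (θt ^ Fintype.card Fq)⁻¹ * ∏' i, omegaFactor Fq i := rfl

/-- The bound is the norm of the constant coefficient, so `GaussLE.inv` applies to `Ω`. -/
lemma gaussLE_Omega (θt : CInf Fq) : GaussLE (Omega θt) (‖θt‖ ^ Fintype.card Fq)⁻¹ := by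
  have h1 := one_lt_norm_theta (Fq := Fq)
  have hf : ∀ i, GaussLE (omegaFactor Fq i) 1 := fun i => by
    have := (gaussLE_omegaFactor_sub_one (Fq := Fq) i).mono
      (pow_le_one₀ (by positivity) (inv_le_one_of_one_le₀ h1.le))
    simpa using this.add gaussLE_one
  have hp : GaussLE (∏' i, omegaFactor Fq i) 1 :=
    GaussLE.of_tendsto multipliable_omegaFactor_and_tendstoUniformly.1.hasProd fun S => by
      simpa using GaussLE.prod (C := fun _ => 1) S fun i _ => hf i
  rw [Omega_eq]
  simpa using (gaussLE_C (θt ^ Fintype.card Fq)⁻¹).mul hp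

lemma constantCoeff_Omega (θt : CInf Fq) :
    constantCoeff (Omega θt) = (θt ^ Fintype.card Fq)⁻¹ := by
  rw [Omega_eq, map_mul, constantCoeff_C,
    multipliable_omegaFactor_and_tendstoUniformly.1.map_tprod _
      (PowerSeries.WithPiTopology.continuous_constantCoeff (CInf Fq))]
  simp [omegaFactor]

lemma isRestricted_Omega (θt : CInf Fq) : IsRestricted 1 (Omega θt) := by
  refine isRestricted.mul 1 (isRestricted_C 1 _)
    (isRestricted_one_of_tendstoUniformly multipliable_omegaFactor_and_tendstoUniformly.2 fun S => ?_)
  refine Finset.prod_induction _ _ (fun _ _ => isRestricted.mul 1) (isRestricted_one 1) fun i _ => ?_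
  have : omegaFactor Fq i = ((1 - Polynomial.C (theta Fq ^ (Fintype.card Fq) ^ (i + 1))⁻¹ *
      Polynomial.X : Polynomial (CInf Fq)) : (CInf Fq)⟦X⟧) := by
    simp [omegaFactor]
  rw [this]
  exact isRestricted_coe _ _

/-- Twisting shifts the product by one index, and `t - θ^q = (-θ)^q (1 - t/θ^q)` restores the lost
factor. The choice of `θ̃` makes the constants agree: `θ̃^(-q²) θ̃^(q(q-1)) = θ̃^(-q)`. -/
lemma twist_one_Omega_mul {θt : CInf Fq} (hθt : θt ^ (Fintype.card Fq - 1) = -theta Fq) :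
    twist Fq 1 (Omega θt) * (X - C (theta Fq ^ Fintype.card Fq)) = Omega θt := by
  have h0 := ne_zero_of_pow_eq_neg_theta hθt
  have hθ0 := theta_ne_zero (Fq := Fq)
  set q := Fintype.card Fq with hq
  have hq2 : 2 ≤ q := two_le_card Fq
  have htw : ∀ i, twist Fq 1 (omegaFactor Fq i) = omegaFactor Fq (i + 1) := by
    intro i
    rw [omegaFactor, map_sub, map_one, map_mul, twist_C, twist_X, frobC_one, omegaFactor, inv_pow,
      ← pow_mul, ← pow_succ]
  obtain ⟨hm, -⟩ := multipliable_omegaFactor_and_tendstoUniformly (Fq := Fq)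
  have hcont : Continuous (twist Fq 1) := by simpa using continuous_twist_natCast Fq 1
  have hm' : Multipliable fun i => omegaFactor Fq (i + 1) := by
    simpa only [Function.comp_def, htw] using hm.map (twist Fq 1) hcont
  have hfac : X - C (theta Fq ^ q) = C ((-theta Fq) ^ q) * omegaFactor Fq 0 := by
    -- Additivity of the `q`-th power gives the sign for odd and even `q` alike.
    have hneg : (-theta Fq) ^ q = -theta Fq ^ q := by
      rw [← frobC_one, ← frobC_one, map_neg]
    rw [omegaFactor, zero_add, pow_one, hneg, mul_sub, ← mul_assoc, ← map_mul, neg_mul,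
      mul_inv_cancel₀ (pow_ne_zero _ hθ0)]
    simp only [map_neg, map_one]
    ring
  rw [Omega_eq, map_mul, hm.map_tprod _ hcont, tprod_eq_zero_mul' hm', twist_C, frobC_one, hfac,
    ← hθt, ← hq]
  simp only [htw]
  have hC : ((θt ^ q)⁻¹) ^ q * (θt ^ (q - 1)) ^ q = (θt ^ q)⁻¹ := by
    rw [inv_pow, ← pow_mul, ← pow_mul, inv_mul_eq_iff_eq_mul₀ (pow_ne_zero _ h0),
      eq_mul_inv_iff_mul_eq₀ (pow_ne_zero _ h0), ← pow_add]
    congr 1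
    rw [Nat.sub_mul, one_mul, Nat.sub_add_cancel (Nat.le_mul_self q)]
  have hC' := congrArg (C (R := CInf Fq)) hC
  rw [map_mul] at hC'
  rw [← hC']
  ring

/-- The functional equation `Ω^(-1) = (t - θ) Ω`. -/
lemma twist_neg_one_Omega {θt : CInf Fq} (hθt : θt ^ (Fintype.card Fq - 1) = -theta Fq) :
    twist Fq (-1) (Omega θt) = (X - C (theta Fq)) * Omega θt := by
  conv_lhs => rw [← twist_one_Omega_mul hθt]
  rw [map_mul, ← twist_add, map_sub, twist_X, twist_C, ← frobC_one, ← frobC_add]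
  simp [twist_zero, frobC_zero, mul_comm]

lemma twist_Omega_mul_prod {θt : CInf Fq} (hθt : θt ^ (Fintype.card Fq - 1) = -theta Fq) (m : ℕ) :
    twist Fq m (Omega θt) * ∏ l ∈ Finset.range m,
      (X - C (theta Fq ^ (Fintype.card Fq) ^ (l + 1))) = Omega θt := by
  induction m with
  | zero => simp [twist_zero]
  | succ m ih =>
    conv_rhs => rw [← ih]
    nth_rewrite 2 [← twist_one_Omega_mul hθt]
    rw [Finset.prod_range_succ, map_mul, ← twist_add, map_sub, twist_X, twist_C, frobC_natCast,
      ← pow_mul, pow_succ']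
    push_cast
    ring

lemma isEntire_Omega {θt : CInf Fq} (hθt : θt ^ (Fintype.card Fq - 1) = -theta Fq) :
    IsEntire Fq (Omega θt) := by
  refine isEntire_of_twist_eq (a := -theta Fq) (b := 1) (isRestricted_Omega θt) isEntire_zero
    ⟨-algebraMap (RatFunc Fq) (KBar Fq) RatFunc.X, by rw [map_neg, kbarToC_theta]⟩ (one_mem _) ?_
  rw [twist_neg_one_Omega hθt]
  simp only [map_neg, map_one]
  ring

end Omega

/-! ### Convergence of the two series and their equality. -/

section Series

open PowerSeries Filter Topology

variable {Fq : Type*} [Field Fq] [Fintype Fq] {θt : CInf Fq} {d : ℕ} {s : Fin d → ℕ}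
  {Q : Fin d → Polynomial (KBar Fq)}

/-- Since `|θ̃| = |θ|^(1/(q-1))`, the bound on `Ω^n` is the reciprocal of the denominator in (*). -/
lemma norm_pow_card_mul (hθt : θt ^ (Fintype.card Fq - 1) = -theta Fq) (n : ℕ) :
    ‖θt‖ ^ (Fintype.card Fq * n) =
      ‖theta Fq‖ ^ ((Fintype.card Fq : ℝ) * n / ((Fintype.card Fq : ℝ) - 1)) := by
  have h2 := two_le_card Fq
  have h : ‖theta Fq‖ = ‖θt‖ ^ ((Fintype.card Fq : ℝ) - 1) := by
    rw [← norm_neg, ← hθt, norm_pow, ← Real.rpow_natCast, Nat.cast_sub (by omega), Nat.cast_one]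
  have h3 : (Fintype.card Fq : ℝ) - 1 ≠ 0 := by
    have : (2 : ℝ) ≤ Fintype.card Fq := by exact_mod_cast h2
    linarith
  rw [h, ← Real.rpow_mul (norm_nonneg _), mul_div_cancel₀ _ h3, ← Real.rpow_natCast]
  push_cast
  rfl

lemma gaussLE_lTerm (hθt : θt ^ (Fintype.card Fq - 1) = -theta Fq) (i : DecTuple d) :
    GaussLE (lTerm θt s Q i) (∏ m, (gaussNorm Fq (Q m) /
      ‖theta Fq‖ ^ ((Fintype.card Fq : ℝ) * s m / ((Fintype.card Fq : ℝ) - 1))) ^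
        (Fintype.card Fq) ^ i.1 m) := by
  refine GaussLE.prod _ fun m _ => GaussLE.twist ?_ _
  rw [← norm_pow_card_mul hθt, div_eq_inv_mul, pow_mul, ← inv_pow]
  exact ((gaussLE_Omega θt).pow _).mul (gaussLE_polyToPS _)

/-- The first index bounds all others, so a limit as `i₁ → ∞` is a limit along the cofinite filter.
-/
lemma finite_decTuple_lt (hd : 0 < d) (N : ℕ) : {i : DecTuple d | i.1 ⟨0, hd⟩ < N}.Finite := by
  have hfin : (Set.univ.pi fun _ : Fin d => Set.Iio N).Finite :=
    Set.Finite.pi fun _ => Set.finite_Iio N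
  refine (hfin.preimage Subtype.val_injective.injOn).subset fun i hi m _ => ?_
  exact lt_of_le_of_lt (i.2.antitone (Fin.mk_le_mk.2 (Nat.zero_le m.1))) hi

lemma gaussLE_lTerm_eventually (hθt : θt ^ (Fintype.card Fq - 1) = -theta Fq)
    (hQ : NormDecay s Q) {ε : ℝ} (hε : 0 < ε) :
    ∀ᶠ i in cofinite, GaussLE (lTerm θt s Q i) ε := by
  rcases Nat.eq_zero_or_pos d with rfl | hd
  · have : Finite (DecTuple 0) := inferInstance
    simp [Filter.cofinite_eq_bot]
  obtain ⟨N, hN⟩ := hQ ε hε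
  rw [eventually_cofinite]
  refine (finite_decTuple_lt hd N).subset fun i hi => ?_
  by_contra h
  exact hi ((gaussLE_lTerm hθt i).mono (hN i hd (not_lt.1 h)).le)

lemma summable_lTerm (hθt : θt ^ (Fintype.card Fq - 1) = -theta Fq) (hQ : NormDecay s Q) :
    Summable (lTerm θt s Q) :=
  (summable_and_tendstoUniformly fun _ => gaussLE_lTerm_eventually hθt hQ).1

lemma hasGaussSum_lTerm (hθt : θt ^ (Fintype.card Fq - 1) = -theta Fq) (hQ : NormDecay s Q) :
    HasGaussSum Fq (lTerm θt s Q) (lSeries θt s Q) :=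
  (summable_and_tendstoUniformly fun _ => gaussLE_lTerm_eventually hθt hQ).2

lemma isRestricted_lSeries (hθt : θt ^ (Fintype.card Fq - 1) = -theta Fq) (hQ : NormDecay s Q) :
    IsRestricted 1 (lSeries θt s Q) := by
  refine isRestricted_one_of_tendstoUniformly (hasGaussSum_lTerm hθt hQ) fun S => ?_
  refine Finset.sum_induction _ _ (fun _ _ => isRestricted.add 1) (isRestricted_zero 1) fun i _ =>
    Finset.prod_induction _ _ (fun _ _ => isRestricted.mul 1) (isRestricted_one 1) fun m _ =>
      isRestricted_one_twist ?_ _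
  refine isRestricted.mul 1 ?_ (isRestricted_coe _ _)
  rw [Finset.pow_eq_prod_const]
  exact Finset.prod_induction _ _ (fun _ _ => isRestricted.mul 1) (isRestricted_one 1) fun _ _ =>
    isRestricted_Omega θt

lemma lTerm_eq_Omega_pow_mul_quotTerm (hθt : θt ^ (Fintype.card Fq - 1) = -theta Fq)
    (i : DecTuple d) : lTerm θt s Q i = Omega θt ^ (∑ m, s m) * quotTerm s Q i := by
  rw [lTerm, quotTerm, ← Finset.prod_pow_eq_pow_sum, ← Finset.prod_mul_distrib]
  refine Finset.prod_congr rfl fun m _ => ?_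
  set P := ∏ l ∈ Finset.range (i.1 m), (X - C (theta Fq ^ (Fintype.card Fq) ^ (l + 1))) with hP
  have hP0 : constantCoeff (P ^ s m) ≠ 0 := by
    rw [map_pow, hP, map_prod]
    exact pow_ne_zero _ (Finset.prod_ne_zero_iff.2 fun l _ => by
      simpa using fun h => absurd h theta_ne_zero)
  conv_rhs => rw [← twist_Omega_mul_prod hθt (i.1 m), ← hP]
  rw [map_mul, map_pow, mul_pow]
  calc _ = twist Fq (i.1 m) (Omega θt) ^ s m * twist Fq (i.1 m) (polyToPS Fq (Q m)) * 1 := by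
        rw [mul_one]
    _ = _ := by rw [← PowerSeries.mul_inv_cancel _ hP0]; ring

lemma constantCoeff_Omega_ne_zero (hθt : θt ^ (Fintype.card Fq - 1) = -theta Fq) :
    constantCoeff (Omega θt) ≠ 0 := by
  rw [constantCoeff_Omega]
  exact inv_ne_zero (pow_ne_zero _ (ne_zero_of_pow_eq_neg_theta hθt))

lemma quotTerm_eq (hθt : θt ^ (Fintype.card Fq - 1) = -theta Fq) (i : DecTuple d) :
    quotTerm s Q i = (Omega θt)⁻¹ ^ (∑ m, s m) * lTerm θt s Q i := by
  rw [lTerm_eq_Omega_pow_mul_quotTerm hθt, ← mul_assoc, ← mul_pow,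
    PowerSeries.inv_mul_cancel _ (constantCoeff_Omega_ne_zero hθt), one_pow, one_mul]

lemma gaussLE_quotTerm_eventually (hθt : θt ^ (Fintype.card Fq - 1) = -theta Fq)
    (hQ : NormDecay s Q) {ε : ℝ} (hε : 0 < ε) :
    ∀ᶠ i in cofinite, GaussLE (quotTerm s Q i) ε := by
  have h0 := constantCoeff_Omega_ne_zero hθt
  have hO : GaussLE (Omega θt) ‖constantCoeff (Omega θt)‖ := by
    rw [constantCoeff_Omega, norm_inv, norm_pow]
    exact gaussLE_Omega θt
  have hC := (hO.inv h0).pow (∑ m, s m)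
  set M := ‖constantCoeff (Omega θt)‖⁻¹ ^ (∑ m, s m)
  have hM : 0 < M := by positivity
  filter_upwards [gaussLE_lTerm_eventually hθt hQ (div_pos hε hM)] with i hi
  rw [quotTerm_eq hθt]
  simpa [mul_div_cancel₀ _ hM.ne'] using hC.mul hi

lemma lSeries_eq_Omega_pow_mul (hθt : θt ^ (Fintype.card Fq - 1) = -theta Fq)
    (hQ : NormDecay s Q) : lSeries θt s Q = Omega θt ^ (∑ m, s m) * ∑' i, quotTerm s Q i := by
  rw [lSeries, ← (summable_and_tendstoUniformly fun _ =>
    gaussLE_quotTerm_eventually hθt hQ).1.tsum_mul_left]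
  exact tsum_congr fun i => lTerm_eq_Omega_pow_mul_quotTerm hθt i

end Series

/-! ### The functional equation of `L`, by splitting off the tuples with last index zero. -/

section Recursion

open PowerSeries Filter Topology

variable {Fq : Type*} [Field Fq] [Fintype Fq] {θt : CInf Fq} {d : ℕ}

/-- The tuple `i₁ + 1 > ⋯ > i_d + 1`. -/
def DecTuple.shift (i : DecTuple d) : DecTuple d :=
  ⟨fun m => i.1 m + 1, fun _ _ h => Nat.succ_lt_succ (i.2 h)⟩

/-- The tuple `i₁ + 1 > ⋯ > i_d + 1 > 0`. -/
def DecTuple.shiftSnoc (i : DecTuple d) : DecTuple (d + 1) :=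
  ⟨Fin.snoc (α := fun _ => ℕ) (fun m => i.1 m + 1) 0, by
    intro m n h
    induction n using Fin.lastCases with
    | last =>
      induction m using Fin.lastCases with
      | last => exact absurd h (lt_irrefl _)
      | cast m => simp
    | cast n =>
      induction m using Fin.lastCases with
      | last => exact absurd h (not_lt.2 (Fin.le_last _))
      | cast m => simpa using i.2 (Fin.castSucc_lt_castSucc_iff.1 h)⟩

lemma DecTuple.shift_injective : Function.Injective (DecTuple.shift (d := d)) := by
  intro i j h
  ext m
  have := congrFun (congrArg Subtype.val h) m
  simpa [DecTuple.shift] using this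

lemma DecTuple.shiftSnoc_injective : Function.Injective (DecTuple.shiftSnoc (d := d)) := by
  intro i j h
  ext m
  have := congrFun (congrArg Subtype.val h) m.castSucc
  simpa [DecTuple.shiftSnoc] using this

lemma DecTuple.isCompl_range :
    IsCompl (Set.range (DecTuple.shift (d := d + 1))) (Set.range (DecTuple.shiftSnoc (d := d))) := by
  rw [isCompl_iff]
  constructor
  · rw [Set.disjoint_left]
    rintro _ ⟨i, rfl⟩ ⟨j, hj⟩
    have := congrFun (congrArg Subtype.val hj) (Fin.last d)
    simp [DecTuple.shift, DecTuple.shiftSnoc] at this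
  · rw [codisjoint_iff]
    refine Set.eq_univ_of_forall fun i => ?_
    by_cases h : i.1 (Fin.last d) = 0
    · have hpos : ∀ m : Fin d, 1 ≤ i.1 m.castSucc := fun m => by
        have := i.2 (Fin.castSucc_lt_last m)
        omega
      refine Or.inr ⟨⟨fun m => i.1 m.castSucc - 1, fun m n hmn => ?_⟩, ?_⟩
      · have := i.2 (Fin.castSucc_lt_castSucc_iff.2 hmn)
        have := hpos n
        simp only
        omega
      · ext m
        induction m using Fin.lastCases with
        | last => simp [DecTuple.shiftSnoc, h]
        | cast m => simp [DecTuple.shiftSnoc, Nat.sub_add_cancel (hpos m)]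
    · have hpos : ∀ m, 1 ≤ i.1 m := fun m => by
        have := i.2.antitone (Fin.le_last m)
        omega
      refine Or.inl ⟨⟨fun m => i.1 m - 1, fun m n hmn => ?_⟩, ?_⟩
      · have := i.2 hmn
        have := hpos n
        simp only
        omega
      · ext m
        simp [DecTuple.shift, Nat.sub_add_cancel (hpos m)]

lemma lTerm_shift (s : Fin d → ℕ) (Q : Fin d → Polynomial (KBar Fq)) (i : DecTuple d) :
    lTerm θt s Q i.shift = twist Fq 1 (lTerm θt s Q i) := by
  rw [lTerm, lTerm, map_prod]
  refine Finset.prod_congr rfl fun m _ => ?_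
  rw [← twist_add, DecTuple.shift, add_comm]
  push_cast
  rfl

lemma lTerm_shiftSnoc (s : Fin (d + 1) → ℕ) (Q : Fin (d + 1) → Polynomial (KBar Fq))
    (i : DecTuple d) :
    lTerm θt s Q i.shiftSnoc = twist Fq 1 (lTerm θt (fun m => s m.castSucc)
      (fun m => Q m.castSucc) i) * (Omega θt ^ s (Fin.last d) * polyToPS Fq (Q (Fin.last d))) := by
  rw [lTerm, Fin.prod_univ_castSucc, ← lTerm_shift]
  simp [lTerm, DecTuple.shift, DecTuple.shiftSnoc, twist_zero]

/-- The functional equation of `L`. -/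
lemma twist_neg_one_lSeries (hθt : θt ^ (Fintype.card Fq - 1) = -theta Fq)
    {s : Fin (d + 1) → ℕ} {Q : Fin (d + 1) → Polynomial (KBar Fq)} (hQ : NormDecay s Q)
    (hQ' : NormDecay (fun m : Fin d => s m.castSucc) fun m => Q m.castSucc) :
    twist Fq (-1) (lSeries θt s Q) = lSeries θt s Q +
      polyToPS Fq (polyTwist Fq (-1) (Q (Fin.last d))) * (X - C (theta Fq)) ^ s (Fin.last d) *
        Omega θt ^ s (Fin.last d) *
          lSeries θt (fun m : Fin d => s m.castSucc) fun m => Q m.castSucc := by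
  have hcont : Continuous (twist Fq 1) := by simpa using continuous_twist_natCast Fq 1
  have h1 := (summable_lTerm hθt hQ).hasSum.map (twist Fq 1) hcont
  have h2 := ((summable_lTerm hθt hQ').hasSum.map (twist Fq 1) hcont).mul_right
    (Omega θt ^ s (Fin.last d) * polyToPS Fq (Q (Fin.last d)))
  -- Tuples with `i_d > 0` sum to `L^(1)`, those with `i_d = 0` to `L'^(1) Ω^(s_d) Q_d`. Applying
  -- the inverse twist to the total gives the claim.
  have h := HasSum.add_isCompl (f := lTerm θt s Q) DecTuple.isCompl_range
    (DecTuple.shift_injective.hasSum_range_iff.2 (by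
      simpa only [Function.comp_def, lTerm_shift] using h1))
    (DecTuple.shiftSnoc_injective.hasSum_range_iff.2 (by
      simpa only [Function.comp_def, lTerm_shiftSnoc] using h2))
  have hL := h.tsum_eq
  change lSeries θt s Q = twist Fq 1 (lSeries θt s Q) + twist Fq 1 (lSeries θt _ _) * _ at hL
  conv_lhs => rw [hL]
  rw [map_add, map_mul, ← twist_add, ← twist_add, map_mul, map_pow, twist_neg_one_Omega hθt,
    polyToPS_polyTwist_neg_one, neg_add_cancel, twist_zero, twist_zero, mul_pow]
  ring

end Recursion

/-! ### Entireness of the initial series and the linear system. -/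

section Solution

open PowerSeries Filter Topology

variable {Fq : Type*} [Field Fq] [Fintype Fq] {θt : CInf Fq} {d : ℕ} {s : Fin d → ℕ}
  {Q : Fin d → Polynomial (KBar Fq)}

lemma lSeries_of_isEmpty (s : Fin 0 → ℕ) (Q : Fin 0 → Polynomial (KBar Fq)) :
    lSeries θt s Q = 1 := by
  have : Unique (DecTuple 0) :=
    { default := ⟨Fin.elim0, fun m => m.elim0⟩, uniq := fun i => Subtype.ext (Subsingleton.elim _ _) }
  rw [lSeries, tsum_eq_single default fun i hi => absurd (Subsingleton.elim _ _) hi]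
  simp [lTerm]

lemma lSeries_eq_zero {m : Fin d} (hm : Q m = 0) : lSeries θt s Q = 0 := by
  have : lTerm θt s Q = 0 := by
    funext i
    exact Finset.prod_eq_zero (Finset.mem_univ m) (by simp [hm])
  rw [lSeries, this]
  exact tsum_zero

lemma twist_neg_one_lSeries_initial_succ (hθt : θt ^ (Fintype.card Fq - 1) = -theta Fq)
    (hQ : ∀ a, NormDecay (initial s a) (initial Q a)) (m : Fin d) :
    twist Fq (-1) (lSeries θt (initial s m.succ) (initial Q m.succ)) =
      lSeries θt (initial s m.succ) (initial Q m.succ) +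
        polyToPS Fq (polyTwist Fq (-1) (Q m)) * (X - C (theta Fq)) ^ s m * Omega θt ^ s m *
          lSeries θt (initial s m.castSucc) (initial Q m.castSucc) :=
  twist_neg_one_lSeries hθt (hQ m.succ) (hQ m.castSucc)

lemma isEntire_lSeries_initial (hθt : θt ^ (Fintype.card Fq - 1) = -theta Fq)
    (hQ : ∀ a, NormDecay (initial s a) (initial Q a)) (a : Fin (d + 1)) :
    IsEntire Fq (lSeries θt (initial s a) (initial Q a)) := by
  induction a using Fin.induction with
  | zero =>
    have : lSeries θt (initial s (0 : Fin (d + 1))) (initial Q 0) = 1 := lSeries_of_isEmpty _ _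
    rw [this]
    exact isEntire_one
  | succ m ih =>
    -- The inhomogeneous term of the functional equation involves only the shorter series, entire by
    -- induction.
    refine isEntire_of_twist_eq (a := 1) (b := 0) (isRestricted_lSeries hθt (hQ m.succ)) ?_
      (one_mem _) (zero_mem _) ?_ (g := polyToPS Fq (polyTwist Fq (-1) (Q m)) *
        (X - C (theta Fq)) ^ s m * Omega θt ^ s m *
          lSeries θt (initial s m.castSucc) (initial Q m.castSucc))
    · rw [← polyToPS_tSubTheta]
      exact (((isEntire_polyToPS _).mul ((isEntire_polyToPS _).pow _)).mul
        ((isEntire_Omega hθt).pow _)).mul ih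
    · rw [twist_neg_one_lSeries_initial_succ hθt hQ]
      simp

lemma tailSum_castSucc (s : Fin d → ℕ) (m : Fin d) :
    tailSum s m.castSucc = s m + tailSum s m.succ := by
  rw [tailSum, tailSum, ← Finset.add_sum_erase _ _ (Finset.mem_univ m),
    ← Finset.add_sum_erase _ (fun n : Fin d => if m.succ.1 ≤ n.1 then s n else 0)
      (Finset.mem_univ m)]
  simp only [Fin.val_castSucc, le_refl, if_true, Fin.val_succ, Nat.not_succ_le_self, if_false,
    zero_add]
  congr 1
  refine Finset.sum_congr rfl fun n hn => ?_
  have hne : n.1 ≠ m.1 := fun h => Finset.ne_of_mem_erase hn (Fin.ext h)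
  by_cases h : m.1 ≤ n.1
  · rw [if_pos h, if_pos (by omega)]
  · rw [if_neg h, if_neg (by omega)]

lemma tailSum_last (s : Fin d → ℕ) : tailSum s (Fin.last d) = 0 := by
  refine Finset.sum_eq_zero fun m _ => if_neg ?_
  simp

lemma psiVec_zero : psiVec θt s Q 0 = Omega θt ^ tailSum s 0 :=
  (congrArg (Omega θt ^ tailSum s 0 * ·) (lSeries_of_isEmpty _ _)).trans (mul_one _)

/-- The vector `ψ` is an entire solution of `ψ^(-1) = Φ ψ` when all initial tuples satisfy the decay
condition. -/
theorem isEntireSolution_psiVec (hθt : θt ^ (Fintype.card Fq - 1) = -theta Fq)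
    (hQ : ∀ a, NormDecay (initial s a) (initial Q a)) :
    IsEntireSolution θt s Q (psiVec θt s Q) := by
  have hO := twist_neg_one_Omega hθt
  refine ⟨fun a => ((isEntire_Omega hθt).pow _).mul (isEntire_lSeries_initial hθt hQ a), ?_, ?_⟩
  · funext b
    rw [Matrix.mulVec, dotProduct]
    induction b using Fin.cases with
    | zero =>
      rw [Finset.sum_eq_single 0]
      · simp [psiVec_zero, Phi, hO, polyToPS_tSubTheta, mul_pow]
      · intro a _ ha
        simp [Phi, ha.symm]
      · simp
    | succ m =>
      have hne : m.succ ≠ m.castSucc := fun h => by simpa using congrArg Fin.val h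
      -- Only the diagonal and subdiagonal entries survive; the row is the functional equation of
      -- `L` times `((t - θ) Ω)` to the power `tailSum s m.succ`.
      rw [Finset.sum_eq_add m.succ m.castSucc hne]
      · have hd : Phi s Q m.succ m.succ = tSubTheta Fq ^ tailSum s m.succ := by simp [Phi]
        have hsub : Phi s Q m.succ m.castSucc =
            polyTwist Fq (-1) (Q m) * tSubTheta Fq ^ tailSum s m.castSucc := by
          simp [Phi, hne]
        simp only [Matrix.map_apply, hd, hsub, psiVec, map_mul, map_pow, hO, polyToPS_tSubTheta,
          mul_pow, twist_neg_one_lSeries_initial_succ hθt hQ m, tailSum_castSucc]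
        ring
      · intro a _ ha
        have h1 : m.succ ≠ a := ha.1.symm
        have h2 : m.succ.1 ≠ a.1 + 1 := fun h => ha.2 (Fin.ext (by simpa using h.symm))
        rw [Matrix.map_apply, Phi, if_neg h1, dif_neg h2, map_zero, zero_mul]
      · simp
      · simp
  · change Omega θt ^ tailSum s (Fin.last d) * lSeries θt s Q = lSeries θt s Q
    rw [tailSum_last, pow_zero, one_mul]

end Solution

/-! ### Passage of the decay condition to initial tuples. -/

section Initial

variable {Fq : Type*} [Field Fq] [Fintype Fq] {d : ℕ} {s : Fin d → ℕ}
  {Q : Fin d → Polynomial (KBar Fq)}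

lemma gaussNorm_nonneg (P : Polynomial (KBar Fq)) : 0 ≤ gaussNorm Fq P :=
  Polynomial.supNorm_nonneg _

lemma gaussNorm_pos {P : Polynomial (KBar Fq)} (hP : P ≠ 0) : 0 < gaussNorm Fq P := by
  refine (gaussNorm_nonneg P).lt_of_ne' fun h => hP ?_
  have h' : P.map (kbarToC Fq) = 0 := (Polynomial.supNorm_eq_zero_iff _).1 h
  exact (Polynomial.map_eq_zero _).1 h'

/-- The tuple `i₁ + (d - a) > ⋯ > i_a + (d - a) > d - a - 1 > ⋯ > 0`. -/
def DecTuple.extend {a : ℕ} (had : a ≤ d) (i : DecTuple a) : DecTuple d :=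
  ⟨fun m => if h : m.1 < a then i.1 ⟨m.1, h⟩ + (d - a) else d - 1 - m.1, by
    intro m n hmn
    have h' : m.1 < n.1 := hmn
    have hn := n.2
    dsimp only
    split_ifs with h1 h2 h2
    · have := i.2 (show (⟨m.1, h2⟩ : Fin a) < ⟨n.1, h1⟩ from h')
      omega
    all_goals omega⟩

/-- The decay condition passes to initial tuples if the remaining polynomials are nonzero. -/
lemma NormDecay.initial (hQ : NormDecay s Q) (h0 : ∀ m : Fin d, 0 < m.1 → Q m ≠ 0)
    (a : Fin (d + 1)) : NormDecay (initial s a) (initial Q a) := by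
  intro ε hε
  have had : a.1 ≤ d := a.is_le
  rcases Nat.eq_zero_or_pos a.1 with ha | ha
  · exact ⟨0, fun _ hd => absurd hd (by omega)⟩
  have hq := two_le_card Fq
  set q := Fintype.card Fq with hqdef
  let x : Fin d → ℝ := fun m => gaussNorm Fq (Q m) /
    ‖theta Fq‖ ^ ((q : ℝ) * s m / ((q : ℝ) - 1))
  have hθ : 0 < ‖theta Fq‖ := one_pos.trans one_lt_norm_theta
  have hx : ∀ m, 0 ≤ x m := fun m => div_nonneg (gaussNorm_nonneg _) (by positivity)
  have hxpos : ∀ m : Fin d, a.1 ≤ m.1 → 0 < x m := fun m hm =>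
    div_pos (gaussNorm_pos (h0 m (by omega))) (by positivity)
  set c := d - a.1 with hc
  -- The factor from the appended indices `d - a - 1 > ⋯ > 0`: it is independent of `i`, and
  -- positive because those polynomials are nonzero.
  let D : ℝ := ∏ m : Fin d, if a.1 ≤ m.1 then x m ^ q ^ (d - 1 - m.1) else 1
  have hD : 0 < D := Finset.prod_pos fun m _ => by
    split_ifs with h
    · exact pow_pos (hxpos m h) _
    · exact one_pos
  -- Shifting the first `a` indices by `c` raises their product to the power `q^c`, so this
  -- threshold yields `ε` after cancelling `D` and taking the root.
  obtain ⟨N, hN⟩ := hQ (ε ^ q ^ c * D) (by positivity)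
  refine ⟨N, fun i _ hi => ?_⟩
  have hd : 0 < d := by omega
  have key := hN (DecTuple.extend had i) hd (by
    simp only [DecTuple.extend, ha, dif_pos]
    exact hi.trans (Nat.le_add_right _ _))
  change ∏ m, x (Fin.castLE had m) ^ q ^ i.1 m < ε
  change ∏ m, x m ^ q ^ (DecTuple.extend had i).1 m < _ at key
  have hprod : ∏ m, x m ^ q ^ (DecTuple.extend had i).1 m =
      (∏ m, x (Fin.castLE had m) ^ q ^ i.1 m) ^ q ^ c * D := by
    have h1 : (∏ m, x (Fin.castLE had m) ^ q ^ i.1 m) ^ q ^ c =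
        ∏ m : Fin d, if h : m.1 < a.1 then x m ^ q ^ (i.1 ⟨m.1, h⟩ + c) else 1 := by
      rw [← Finset.prod_pow]
      symm
      refine (Finset.prod_of_injOn (Fin.castLE had) (Fin.castLE_injective had).injOn
        (fun _ _ => Finset.mem_coe.2 (Finset.mem_univ _)) ?_ ?_).symm
      · intro m _ hm
        refine dif_neg fun h => hm ⟨⟨m.1, h⟩, by simp, by ext; rfl⟩
      · intro m _
        have : (Fin.castLE had m).1 < a.1 := m.2
        rw [dif_pos this, ← pow_mul, ← pow_add]
        rfl
    rw [h1, ← Finset.prod_mul_distrib]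
    refine Finset.prod_congr rfl fun m _ => ?_
    by_cases h : m.1 < a.1
    · simp [DecTuple.extend, h, hc]
    · simp [DecTuple.extend, h, not_lt.1 h]
  rw [hprod] at key
  exact lt_of_pow_lt_pow_left₀ _ hε.le (lt_of_mul_lt_mul_right key hD.le)

end Initial

end CarlitzTwist

end

open CarlitzTwist in
theorem lemma5 {Fq : Type*} [Field Fq] [Fintype Fq]
    (θt : CInf Fq) (hθt : θt ^ (Fintype.card Fq - 1) = -theta Fq)
    {d : ℕ} (s : Fin d → ℕ) (hs : ∀ m, 0 < s m)
    (Q : Fin d → Polynomial (KBar Fq)) (hQ : NormDecay s Q) :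
    HasGaussSum Fq (lTerm θt s Q) (lSeries θt s Q) ∧
    HasGaussSum Fq (quotTerm s Q) (∑' i, quotTerm s Q i) ∧
    lSeries θt s Q = Omega θt ^ (∑ m, s m) * ∑' i, quotTerm s Q i ∧
    IsEntire Fq (lSeries θt s Q) ∧
    (∃ ψ, IsEntireSolution θt s Q ψ) ∧
    ((∀ a, NormDecay (initial s a) (initial Q a)) → IsEntireSolution θt s Q (psiVec θt s Q)) ∧
    ((∀ m : Fin d, 0 < m.1 → Q m ≠ 0) → ∀ a, NormDecay (initial s a) (initial Q a)) := by
  have hsol : ∃ ψ, IsEntireSolution θt s Q ψ := by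
    -- With a zero `Q m`, (*) may fail for shorter tuples, but then `L = 0` and the zero vector is a
    -- solution.
    by_cases h0 : ∃ m, Q m = 0
    · obtain ⟨m, hm⟩ := h0
      refine ⟨0, fun _ => isEntire_zero, ?_, (lSeries_eq_zero hm).symm⟩
      rw [Matrix.mulVec_zero]
      funext a
      exact map_zero _
    · push Not at h0
      exact ⟨_, isEntireSolution_psiVec hθt (hQ.initial fun m _ => h0 m)⟩
  refine ⟨hasGaussSum_lTerm hθt hQ,
    (summable_and_tendstoUniformly fun _ => gaussLE_quotTerm_eventually hθt hQ).2,
    lSeries_eq_Omega_pow_mul hθt hQ, ?_, hsol, isEntireSolution_psiVec hθt, hQ.initial⟩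
  obtain ⟨ψ, hψ⟩ := hsol
  -- As the last coordinate of an entire solution, `L` is entire in both cases.
  rw [← hψ.2.2]
  exact hψ.1 _
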